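/- **Proposition (Particle formulation of the transport Newton flow).** Let $M=\mathbb T^d=\mathbb R^d/\mathbb Z^d$, let $\mathcal P$ be the set of smooth positive probability densities on $M$ and, for $\rho\in\mathcal P$, let $T_\rho\mathcal P=\{\sigma\in C^\infty(M):\int\sigma\,dx=0\}$. Let $\mathcal E:\mathcal P\to\mathbb R$ be a smooth functional with first variation $\delta\mathcal E(\rho)\in C^\infty(M)$ (determined up to a constant) and second variation $\delta^2\mathcal E(\rho)$, a bilinear form on $T_\rho\mathcal P$ whose kernel $\delta^2\mathcal E(\rho)(x,y)$ may be a distribution and which maps $T_\rho\mathcal P$ to $C^\infty(M)$. With potentials $\Phi_i$, $\sigma_i=-\nabla\cdot(\rho\nabla\Phi_i)$, the transport Hessian metric is $$\mathrm g^{\mathrm H}(\rho)(\sigma_1,\sigma_2)=\iint\delta^2\mathcal E(\rho)(x,y)\,\sigma_1(x)\sigma_2(y)\,dx\,dy-\int\delta\mathcal E(\rho)\,\boldsymbol\Gamma(\rho)(\sigma_1,\sigma_2)\,dx ,$$ where $\boldsymbol\Gamma(\rho)(\sigma_1,\sigma_2)=-\tfrac12\{\Delta_{\sigma_1}\Delta_\rho^{-1}\sigma_2+\Delta_{\sigma_2}\Delta_\rho^{-1}\sigma_1+\Delta_\rho(\nabla\Delta_\rho^{-1}\sigma_1,\nabla\Delta_\rho^{-1}\sigma_2)\}$,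 $\Delta_a=\nabla\cdot(a\nabla)$, so that $\Delta_\rho^{-1}\sigma_i=-\Phi_i$. The transport Newton flow of $\mathcal E$ on $[0,T]$ is the gradient flow of $\mathcal E$ in this metric: a smooth curve $\rho$ in $\mathcal P$ with $\partial_t\rho=-\mathrm{grad}_{\mathrm g^{\mathrm H}}\mathcal E(\rho)=\nabla\cdot(\rho\nabla\Phi)$, where $\nabla\Phi$ is smooth in $(t,x)$ on $[0,T]\times M$ and $\mathrm g^{\mathrm H}(\rho)(\sigma,-\nabla\cdot(\rho\nabla\Phi))=\int\delta\mathcal E(\rho)\sigma\,dx$ for every $\sigma=-\nabla\cdot(\rho\nabla\Psi)$, $\Psi\in C^\infty(M)$. Let $$\mathrm H(x,y,\rho)=\delta^2\mathcal E(\rho)(x,y)\,\nabla_x\cdot(\rho\nabla_x)\,\nabla_y\cdot(\rho\nabla_y)-\nabla_x\cdot(\rho\,\nabla_x^2\delta\mathcal E(\rho)\nabla_x)\,\delta(x-y),$$ understood as the bilinear form obtained by testing against $\varphi(x)\psi(y)$ with $\varphi,\psi\in C^\infty(M)$. Let $T>0$ and let $(\rho_t)_{t\in[0,T]}$ be a smooth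 curve in $\mathcal P$. Suppose that, for each $t\in[0,T]$ and $\rho=\rho_t$, the operator $\mathrm H$ has an inverse kernel $K_{\mathrm H}(x,y,\rho)$ with $K_{\mathrm H}(x,\cdot,\rho)\in L^1(M)$ for every $x$. Here the inverse is taken between $C^\infty(M)$ modulo constants and $T_\rho\mathcal P$: for $g\in T_\rho\mathcal P$ the function $K_{\mathrm H}g=\int K_{\mathrm H}(\cdot,y,\rho)g(y)\,dy$ is smooth with $\mathrm HK_{\mathrm H}g=g$, and $K_{\mathrm H}\mathrm H\varphi=\varphi$ up to a constant for $\varphi\in C^\infty(M)$ with $\mathrm H\varphi\in C^\infty(M)$. Suppose also that for every $x$ the derivative $\nabla_x\nabla_yK_{\mathrm H}(x,\cdot,\rho)$, in the sense of distributions in $y$, is an integrable function. Put $$V_t(x)=-\mathbb E_{Y\sim\rho_t}\big[\nabla_x\nabla_yK_{\mathrm H}(x,Y,\rho_t)\,\nabla_y\delta\mathcal E(\rho_t)(Y)\big].$$ Let $X_0$ be an $M$-valued random variable with law $\rho_0\,dx$ on a probability space $\Omega$. 1. $(\rho_t)$ is a transport Newton flow of $\mathcal E$ on $[0,T]$ if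 and only if $V$ is smooth on $[0,T]\times M$ and there is a process $(X_t)_{t\in[0,T]}$ on $\Omega$, starting at $X_0$, with $X_t\sim\rho_t$ for all $t$ and, almost surely, for all $t\in[0,T]$, $$\frac{d}{dt}X_t=-\mathbb E_{Y_t\sim\rho_t}\big[\nabla_x\nabla_yK_{\mathrm H}(X_t,Y_t,\rho_t)\,\nabla_y\delta\mathcal E(\rho_t)(Y_t)\big],$$ the expectation being over $Y_t$ only, with $X_t$ held fixed. 2. If $(\rho_t)$ is a transport Newton flow of $\mathcal E$ on $[0,T]$, then every process $X$ on $\Omega$ that almost surely solves this equation on $[0,T]$ and whose initial value has law $\rho_0\,dx$ satisfies $X_t\sim\rho_t$ for all $t\in[0,T]$. In particular, let $f\in C^\infty(M)$ and $\mathcal E(\rho)=\int\rho\log\frac{\rho}{e^{-f}}\,dx$, let the above assumptions on $K_{\mathrm H}$ hold, and suppose that for every $x$ the derivative $\nabla_x\Delta_yK_{\mathrm H}(x,\cdot,\rho_t)$, in the sense of distributions in $y$, is also an integrable function. Then for all $t\in[0,T]$ and $x\in M$ $$V_t(x)=-\mathbb E_{Y\sim\rho_t}\big[\nabla_x\nabla_yK_{\mathrm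 H}(x,Y,\rho_t)\nabla_yf(Y)\big]+\mathbb E_{Y\sim\rho_t}\big[\nabla_x\Delta_yK_{\mathrm H}(x,Y,\rho_t)\big],$$ and 1 and 2 hold with $V$ given by this formula, i.e. with the particle equation $$\frac{d}{dt}X_t=-\mathbb E_{Y_t\sim\rho_t}\big[\nabla_x\nabla_yK_{\mathrm H}(X_t,Y_t,\rho_t)\nabla_yf(Y_t)\big]+\mathbb E_{Y_t\sim\rho_t}\big[\nabla_x\Delta_yK_{\mathrm H}(X_t,Y_t,\rho_t)\big].$$ -/

import Mathlib

open MeasureTheory Set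
open scoped ContDiff

noncomputable section

namespace TransportNewton

/-! ### Calculus on the flat torus -/

/-- The flat torus `ℝ^d / ℤ^d`, with its Haar probability measure `volume`. -/
abbrev Torus (d : ℕ) : Type := UnitAddTorus (Fin d)

/-- The tangent space of the torus at any point. -/
abbrev Vec (d : ℕ) : Type := EuclideanSpace ℝ (Fin d)

/-- The covering map `ℝ^d → ℝ^d / ℤ^d`. -/
def proj {d : ℕ} (v : Vec d) : Torus d := fun i => ((v i : ℝ) : UnitAddCircle)

/-- `f ∈ C^∞(M)`. -/
def Smooth {d : ℕ} (f : Torus d → ℝ) : Prop :=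
  ContDiff ℝ ∞ fun v : Vec d => f (proj v)

/-- The time-dependent field `V` is `C^∞` on `[0,T] × M`. -/
def SmoothOnCylinder {d : ℕ} {F : Type*} [NormedAddCommGroup F] [NormedSpace ℝ F]
    (T : ℝ) (V : ℝ → Torus d → F) : Prop :=
  ContDiffOn ℝ ∞ (fun p : ℝ × Vec d => V p.1 (proj p.2)) (Icc 0 T ×ˢ univ)

/-- The point `x + s e_i`. -/
def shift {d : ℕ} (x : Torus d) (i : Fin d) (s : ℝ) : Torus d :=
  x + proj (s • EuclideanSpace.single i (1 : ℝ))

/-- The partial derivative `∂_i f (x)`. -/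
def pd {d : ℕ} (i : Fin d) (f : Torus d → ℝ) (x : Torus d) : ℝ :=
  deriv (fun s : ℝ => f (shift x i s)) 0

/-- The Euclidean gradient `∇ f (x)`. -/
def grad {d : ℕ} (f : Torus d → ℝ) (x : Torus d) : Vec d :=
  WithLp.toLp 2 fun i => pd i f x

/-- The Laplacian `Δ f = ∑ i, ∂_i ∂_i f`. -/
def laplacian {d : ℕ} (f : Torus d → ℝ) (x : Torus d) : ℝ :=
  ∑ i, pd i (pd i f) x

/-- The weighted Laplacian `Δ_a f = ∇ · (a ∇ f)`. -/
def wLaplacian {d : ℕ} (a f : Torus d → ℝ) (x : Torus d) : ℝ :=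
  ∑ i, pd i (fun z => a z * pd i f z) x

/-- `∇² h (∇ f, ∇ g)`. -/
def hessApply {d : ℕ} (h f g : Torus d → ℝ) (x : Torus d) : ℝ :=
  ∑ i, ∑ j, pd i (pd j h) x * pd i f x * pd j g x

/-! ### Densities, energies and their variations -/

/-- The space `𝒫` of smooth positive probability densities. -/
def Densities (d : ℕ) : Set (Torus d → ℝ) :=
  {ρ | Smooth ρ ∧ (∀ x, 0 < ρ x) ∧ ∫ x, ρ x = 1}

/-- The tangent space `T_ρ 𝒫`: smooth functions of zero integral. -/
def Tangents (d : ℕ) : Set (Torus d → ℝ) :=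
  {σ | Smooth σ ∧ ∫ x, σ x = 0}

/-- The probability measure `ρ dx`. -/
def densityMeasure {d : ℕ} (ρ : Torus d → ℝ) : Measure (Torus d) :=
  volume.withDensity fun x => ENNReal.ofReal (ρ x)

/-- `h` is an `L²` first variation of `E` at `ρ`. On `𝒫` it is determined up to an additive
constant. -/
def IsFirstVariation {d : ℕ} (E : (Torus d → ℝ) → ℝ) (ρ h : Torus d → ℝ) : Prop :=
  Smooth h ∧ ∀ σ ∈ Tangents d,
    HasDerivAt (fun ε : ℝ => E (ρ + ε • σ)) (∫ x, h x * σ x) 0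

open Classical in
/-- The first variation `δE(ρ)`; the additive constant left free is chosen arbitrarily, and
nothing below depends on it. -/
def firstVariation {d : ℕ} (E : (Torus d → ℝ) → ℝ) (ρ : Torus d → ℝ) : Torus d → ℝ :=
  if h : ∃ h, IsFirstVariation E ρ h then h.choose else 0

/-- The second variation as a bilinear form,
`∫∫ δ²E(ρ)(x,y) σ₁(x) σ₂(y) dx dy = ∂_s ∂_t E(ρ + t σ₁ + s σ₂)` at `s = t = 0`.
The kernel `δ²E(ρ)(x,y)` may be a distribution, as for the entropy. -/
def secondVariation {d : ℕ} (E : (Torus d → ℝ) → ℝ) (ρ σ₁ σ₂ : Torus d → ℝ) : ℝ :=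
  deriv (fun s : ℝ => deriv (fun t : ℝ => E (ρ + t • σ₁ + s • σ₂)) 0) 0

/-- Smooth energy functionals on `𝒫`: smooth on affine slices, with first variation in `C^∞(M)`
and second variation mapping `T_ρ 𝒫` to `C^∞(M)`. -/
structure IsSmoothFunctional {d : ℕ} (E : (Torus d → ℝ) → ℝ) : Prop where
  slices : ∀ ρ ∈ Densities d, ∀ σ₁ ∈ Tangents d, ∀ σ₂ ∈ Tangents d,
    ContDiffAt ℝ ∞ (fun p : ℝ × ℝ => E (ρ + p.1 • σ₁ + p.2 • σ₂)) 0
  first : ∀ ρ ∈ Densities d, ∃ h, IsFirstVariation E ρ h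
  second : ∀ ρ ∈ Densities d, ∀ σ₂ ∈ Tangents d, ∃ k, Smooth k ∧
    ∀ σ₁ ∈ Tangents d, secondVariation E ρ σ₁ σ₂ = ∫ x, k x * σ₁ x

/-- The Kullback-Leibler divergence `∫ ρ log (ρ / e^{-f}) dx`. -/
def klEnergy {d : ℕ} (f : Torus d → ℝ) (ρ : Torus d → ℝ) : ℝ :=
  ∫ x, ρ x * Real.log (ρ x / Real.exp (-f x))

/-! ### The transport Hessian metric and its gradient flows

Tangent vectors are written through their potentials: `σ = -∇ · (ρ ∇ Φ)`, that is
`Δ_ρ⁻¹ σ = -Φ` with `Δ_ρ = ∇ · (ρ ∇)`. -/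

/-- The tangent vector `σ = -∇ · (ρ ∇ Φ)` with potential `Φ`. -/
def tangentOf {d : ℕ} (ρ Φ : Torus d → ℝ) (x : Torus d) : ℝ :=
  -wLaplacian ρ Φ x

/-- The Christoffel symbol of the transport metric at `σ₁, σ₂` with potentials `Φ₁, Φ₂`:
`-1/2 (Δ_{σ₁} Δ_ρ⁻¹ σ₂ + Δ_{σ₂} Δ_ρ⁻¹ σ₁ + Δ_ρ (∇ Δ_ρ⁻¹ σ₁, ∇ Δ_ρ⁻¹ σ₂))`. -/
def christoffel {d : ℕ} (ρ Φ₁ Φ₂ : Torus d → ℝ) (x : Torus d) : ℝ :=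
  -(1 / 2) * (wLaplacian (tangentOf ρ Φ₁) (-Φ₂) x + wLaplacian (tangentOf ρ Φ₂) (-Φ₁) x
    + wLaplacian ρ (fun z => inner ℝ (grad (-Φ₁) z) (grad (-Φ₂) z)) x)

/-- The transport Hessian metric `g^H(ρ)(σ₁, σ₂) = Hess_g E(ρ)(σ₁, σ₂)` at the tangent vectors
with potentials `Φ₁, Φ₂`. -/
def hessianMetric {d : ℕ} (E : (Torus d → ℝ) → ℝ) (ρ Φ₁ Φ₂ : Torus d → ℝ) : ℝ :=
  secondVariation E ρ (tangentOf ρ Φ₁) (tangentOf ρ Φ₂)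
    - ∫ x, firstVariation E ρ x * christoffel ρ Φ₁ Φ₂ x

/-- `-∇ · (ρ ∇ Φ)` is the gradient at `ρ` of the functional `F` for the metric `g^H` of `E`:
`g^H(ρ)(σ, grad F) = ∫ δF(ρ) σ dx` for every tangent vector `σ = -∇ · (ρ ∇ Ψ)`. -/
def IsGradientPotential {d : ℕ} (E F : (Torus d → ℝ) → ℝ) (ρ Φ : Torus d → ℝ) : Prop :=
  Smooth Φ ∧ ∀ Ψ, Smooth Ψ →
    hessianMetric E ρ Ψ Φ = ∫ x, firstVariation F ρ x * tangentOf ρ Ψ x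

/-- A smooth curve `[0,T] → 𝒫`. -/
def IsDensityCurve {d : ℕ} (T : ℝ) (ρ : ℝ → Torus d → ℝ) : Prop :=
  SmoothOnCylinder T ρ ∧ ∀ t ∈ Icc (0 : ℝ) T, ρ t ∈ Densities d

/-- `∂_t ρ = -grad_{g^H} F(ρ)` on `[0,T]`, with the potentials `Φ t` (which are determined up to
constants) depending smoothly on time. -/
def IsHessianGradientFlow {d : ℕ} (E F : (Torus d → ℝ) → ℝ) (T : ℝ) (ρ : ℝ → Torus d → ℝ) :
    Prop :=
  IsDensityCurve T ρ ∧ ∃ Φ : ℝ → Torus d → ℝ,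
    SmoothOnCylinder T (fun t => grad (Φ t)) ∧
    ∀ t ∈ Icc (0 : ℝ) T, IsGradientPotential E F (ρ t) (Φ t) ∧
      ∀ x, HasDerivWithinAt (fun s => ρ s x) (-tangentOf (ρ t) (Φ t) x) (Icc 0 T) t

/-- The transport Newton flow of `E`: the gradient flow of `E` in the metric `g^H = Hess_g E`. -/
def IsNewtonFlow {d : ℕ} (E : (Torus d → ℝ) → ℝ) (T : ℝ) (ρ : ℝ → Torus d → ℝ) : Prop :=
  IsHessianGradientFlow E E T ρ

/-! ### The kernel `K_H = H⁻¹` and its derivatives -/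

/-- The kernel
`H(x,y,ρ) = δ²E(ρ)(x,y) ∇_x·(ρ∇_x) ∇_y·(ρ∇_y) - ∇_x·(ρ ∇_x² δE(ρ) ∇_x) δ(x-y)`
tested against `φ(x) ψ(y)`. -/
def kernelH {d : ℕ} (E : (Torus d → ℝ) → ℝ) (ρ φ ψ : Torus d → ℝ) : ℝ :=
  secondVariation E ρ (wLaplacian ρ φ) (wLaplacian ρ ψ)
    + ∫ x, hessApply (firstVariation E ρ) φ ψ x * ρ x

/-- The function `x ↦ ∫ K(x,y) g(y) dy`. -/
def applyKernel {d : ℕ} (K : Torus d → Torus d → ℝ) (g : Torus d → ℝ) (x : Torus d) : ℝ :=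
  ∫ y, K x y * g y

/-- `K = H(·,·,ρ)⁻¹`. Since `H` annihilates constants and has range in the functions of zero
integral, the inverse is taken between `C^∞(M)` modulo constants and `T_ρ 𝒫`:
`H K g = g` for `g` of zero integral, and `K H φ = φ` up to a constant. -/
structure IsInverseKernel {d : ℕ} (E : (Torus d → ℝ) → ℝ) (ρ : Torus d → ℝ)
    (K : Torus d → Torus d → ℝ) : Prop where
  integrable : ∀ x, Integrable (K x)
  right_smooth : ∀ g ∈ Tangents d, Smooth (applyKernel K g)
  right_inv : ∀ g ∈ Tangents d, ∀ φ, Smooth φ →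
    kernelH E ρ φ (applyKernel K g) = ∫ x, φ x * g x
  left_inv : ∀ φ g, Smooth φ → Smooth g →
    (∀ ψ, Smooth ψ → kernelH E ρ ψ φ = ∫ x, ψ x * g x) →
    ∃ c : ℝ, ∀ x, applyKernel K g x = φ x + c

/-- `N(x,y) = ∇_x ∇_y K(x,y)`: for every `x`, the entry `N(x,·) i j` is an integrable function
which is the derivative `∂_{x_i} ∂_{y_j} K(x,·)` in the sense of distributions in `y`. -/
structure IsGradGrad {d : ℕ} (K : Torus d → Torus d → ℝ)
    (N : Torus d → Torus d → Matrix (Fin d) (Fin d) ℝ) : Prop where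
  integrable : ∀ x i j, Integrable fun y => N x y i j
  deriv : ∀ x i j φ, Smooth φ →
    HasDerivAt (fun s : ℝ => applyKernel K (pd j φ) (shift x i s)) (-∫ y, N x y i j * φ y) 0

/-- `L(x,y) = ∇_x Δ_y K(x,y)`, in the same sense. -/
structure IsGradLaplacian {d : ℕ} (K : Torus d → Torus d → ℝ)
    (L : Torus d → Torus d → Vec d) : Prop where
  integrable : ∀ x i, Integrable fun y => L x y i
  deriv : ∀ x i φ, Smooth φ →
    HasDerivAt (fun s : ℝ => applyKernel K (laplacian φ) (shift x i s)) (∫ y, L x y i * φ y) 0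

/-! ### Particles -/

/-- The velocity `x ↦ 𝔼_{Y ∼ ρ} [N(x,Y) ∇ h(Y)]`. -/
def expectGrad {d : ℕ} (N : Torus d → Torus d → Matrix (Fin d) (Fin d) ℝ)
    (ρ h : Torus d → ℝ) (x : Torus d) : Vec d :=
  ∫ y, WithLp.toLp 2 (Matrix.mulVec (N x y) (grad h y).ofLp) ∂(densityMeasure ρ)

/-- The drift `x ↦ -𝔼_{Y ∼ ρ} [∇_x ∇_y K_H(x,Y,ρ) ∇_y δE(ρ)(Y)]`. -/
def newtonDrift {d : ℕ} (E : (Torus d → ℝ) → ℝ)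
    (N : (Torus d → ℝ) → Torus d → Torus d → Matrix (Fin d) (Fin d) ℝ)
    (ρ : Torus d → ℝ) (x : Torus d) : Vec d :=
  -expectGrad (N ρ) ρ (firstVariation E ρ) x

/-- The drift
`x ↦ -𝔼_{Y ∼ ρ} [∇_x ∇_y K_H(x,Y,ρ) ∇_y f(Y)] + 𝔼_{Y ∼ ρ} [∇_x Δ_y K_H(x,Y,ρ)]`. -/
def klDrift {d : ℕ} (f : Torus d → ℝ)
    (N : (Torus d → ℝ) → Torus d → Torus d → Matrix (Fin d) (Fin d) ℝ)
    (L : (Torus d → ℝ) → Torus d → Torus d → Vec d)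
    (ρ : Torus d → ℝ) (x : Torus d) : Vec d :=
  -expectGrad (N ρ) ρ f x + ∫ y, L ρ x y ∂(densityMeasure ρ)

/-- The path `c` in the torus satisfies `dc/dt = V(t, c(t))` on `[0,T]`; the derivative is that
of a lift of `c` to `ℝ^d`. -/
def SolvesODE {d : ℕ} (T : ℝ) (V : ℝ → Torus d → Vec d) (c : ℝ → Torus d) : Prop :=
  ∃ γ : ℝ → Vec d, ∀ t ∈ Icc (0 : ℝ) T,
    c t = proj (γ t) ∧ HasDerivWithinAt γ (V t (c t)) (Icc 0 T) t

/-- `X_t ∼ ρ_t` for all `t ∈ [0,T]`. -/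
def HasDensity {d : ℕ} {Ω : Type*} [MeasurableSpace Ω] (P : Measure Ω) (T : ℝ)
    (ρ : ℝ → Torus d → ℝ) (X : ℝ → Ω → Torus d) : Prop :=
  ∀ t ∈ Icc (0 : ℝ) T, ProbabilityTheory.HasLaw (X t) (densityMeasure (ρ t)) P

/-- Almost every path of `X` satisfies `dX/dt = V(t, X_t)` on `[0,T]`. -/
def IsDrivenBy {d : ℕ} {Ω : Type*} [MeasurableSpace Ω] (P : Measure Ω) (T : ℝ)
    (V : ℝ → Torus d → Vec d) (X : ℝ → Ω → Torus d) : Prop :=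
  ∀ᵐ w ∂P, SolvesODE T V fun t => X t w

end TransportNewton

end

/-! The argument has an Eulerian half and a Lagrangian half, which meet in the continuity equation
`∂_t ρ + ∇ · (ρ V) = 0`.

Eulerian half. Integrating the Christoffel term by parts, the derivatives of order two of the
potentials cancel and only `∇² δE (∇Φ₁, ∇Φ₂)` survives; hence `g^H`, read in potentials, is exactly
the form `H` (`hessianMetric_eq_kernelH`). The gradient condition becomes `H Φ = -∇ · (ρ ∇ δE)`, so
`Φ = -K_H (∇ · (ρ ∇ δE))` up to a constant. Moving `∇_y` from the test function onto `K_H`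
identifies `V` with `-∇Φ` (`newtonDrift_eq_grad`). Thus a Newton flow is the same as a smooth `V`
satisfying the continuity equation (`isNewtonFlow_iff`).

Lagrangian half. If the particles have law `ρ_t`, comparing first order expansions in time of `𝔼
u(X_t)` and `∫ u ρ_t` gives the weak, hence the pointwise, continuity equation. For the converse,
let `D_t(u) = 𝔼 u(X_t) - ∫ u ρ_t`. One Euler step gives `D_{t+h}(u) = D_t(u ∘ (id + h V_t)) +
O(h²)`. The pullbacks keep derivative bounds uniform over `n` steps of length `t/n`, and `D_0 = 0`,
so `D_t(u) = O(1/n)`. This discrete duality replaces solving the backward transport equation, and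
needs no differentiability of the flow in its initial point. Smooth functions determine the law by
Stone–Weierstrass. Existence of the process comes from Picard–Lindelöf, and Grönwall uniqueness
makes arbitrary solutions measurable functions of their initial value.

For the Kullback–Leibler energy, `ρ ∇ δE = ρ ∇f + ∇ρ`, and one more integration by parts in `y`
turns the `∇ρ` term into the `∇_x Δ_y K_H` term. -/

namespace TransportNewton

/-! ### Calculus on the torus through lifts to `ℝ^d`. -/

variable {d : ℕ}

/-! ### The covering map -/

instance isProbabilityMeasure_torus : IsProbabilityMeasure (volume : Measure (Torus d)) :=
  ⟨by rw [volume_pi, Measure.pi_univ]; simp⟩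

lemma proj_zero : proj (0 : Vec d) = 0 := by
  ext i; simp [proj]

lemma proj_add (v w : Vec d) : proj (v + w) = proj v + proj w := by
  ext i; simp [proj]

lemma proj_sub (v w : Vec d) : proj (v - w) = proj v - proj w := by
  ext i; simp [proj]

lemma isOpenQuotientMap_proj : IsOpenQuotientMap (proj : Vec d → Torus d) := by
  have h1 : IsOpenQuotientMap
      (Pi.map fun (_ : Fin d) (r : ℝ) => (r : UnitAddCircle)) :=
    IsOpenQuotientMap.piMap fun _ => QuotientAddGroup.isOpenQuotientMap_mk
  exact h1.comp (PiLp.homeomorph 2 fun _ : Fin d => ℝ).isOpenQuotientMap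

lemma continuous_proj : Continuous (proj : Vec d → Torus d) :=
  isOpenQuotientMap_proj.continuous

lemma surjective_proj : Function.Surjective (proj : Vec d → Torus d) :=
  isOpenQuotientMap_proj.surjective

/-- The lift of a point of the torus to the unit cube. -/
noncomputable def liftCube (x : Torus d) : Vec d :=
  WithLp.toLp 2 fun i => (AddCircle.measurableEquivIco 1 0 (x i) : ℝ)

lemma proj_liftCube (x : Torus d) : proj (liftCube x) = x := by
  ext i
  exact AddCircle.coe_equivIco

lemma measurable_liftCube : Measurable (liftCube : Torus d → Vec d) := by
  refine (PiLp.continuous_toLp 2 _).measurable.comp (measurable_pi_lambda _ fun i => ?_)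
  exact measurable_subtype_coe.comp
    ((AddCircle.measurableEquivIco 1 0).measurable.comp (measurable_pi_apply i))

lemma norm_liftCube_le (x : Torus d) : ‖liftCube x‖ ≤ Real.sqrt d := by
  rw [EuclideanSpace.norm_eq]
  refine Real.sqrt_le_sqrt ?_
  calc ∑ i, ‖liftCube x i‖ ^ 2 ≤ ∑ _i : Fin d, (1 : ℝ) := by
        refine Finset.sum_le_sum fun i _ => ?_
        have h := (AddCircle.measurableEquivIco (1 : ℝ) 0 (x i)).2
        have h0 : 0 ≤ liftCube x i := h.1
        have h1 : liftCube x i < 0 + 1 := h.2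
        rw [Real.norm_eq_abs, sq_abs]
        nlinarith
    _ = d := by simp

lemma shift_proj (v : Vec d) (i : Fin d) (s : ℝ) :
    shift (proj v) i s = proj (v + s • EuclideanSpace.single i (1 : ℝ)) := by
  rw [shift, proj_add]

lemma shift_zero (x : Torus d) (i : Fin d) : shift x i 0 = x := by
  simp [shift, proj_zero]

/-! ### Smooth functions and partial derivatives -/

lemma Smooth.continuous {f : Torus d → ℝ} (hf : Smooth f) : Continuous f := by
  rw [isOpenQuotientMap_proj.isQuotientMap.continuous_iff]
  exact ContDiff.continuous hf

lemma Smooth.integrable {f : Torus d → ℝ} (hf : Smooth f) : Integrable f :=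
  hf.continuous.integrable_of_hasCompactSupport (HasCompactSupport.of_compactSpace f)

lemma Smooth.exists_bound {f : Torus d → ℝ} (hf : Smooth f) : ∃ C, 0 ≤ C ∧ ∀ x, |f x| ≤ C := by
  obtain ⟨C, hC⟩ := (isCompact_univ (X := Torus d)).exists_bound_of_continuousOn
    hf.continuous.continuousOn
  exact ⟨C, (norm_nonneg _).trans (hC 0 (mem_univ _)), fun x => hC x (mem_univ _)⟩

lemma smooth_const (c : ℝ) : Smooth fun _ : Torus d => c := contDiff_const

lemma Smooth.add {f g : Torus d → ℝ} (hf : Smooth f) (hg : Smooth g) :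
    Smooth fun x => f x + g x := ContDiff.add hf hg

lemma Smooth.sub {f g : Torus d → ℝ} (hf : Smooth f) (hg : Smooth g) :
    Smooth fun x => f x - g x := ContDiff.sub hf hg

lemma Smooth.neg {f : Torus d → ℝ} (hf : Smooth f) : Smooth fun x => -f x := ContDiff.neg hf

lemma Smooth.mul {f g : Torus d → ℝ} (hf : Smooth f) (hg : Smooth g) :
    Smooth fun x => f x * g x := ContDiff.mul hf hg

lemma Smooth.sum {ι : Type*} {s : Finset ι} {f : ι → Torus d → ℝ} (hf : ∀ i ∈ s, Smooth (f i)) :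
    Smooth fun x => ∑ i ∈ s, f i x := ContDiff.sum hf

lemma Smooth.log {f : Torus d → ℝ} (hf : Smooth f) (h : ∀ x, 0 < f x) :
    Smooth fun x => Real.log (f x) :=
  ContDiff.log hf fun v => (h (proj v)).ne'

lemma Smooth.hasDerivAt {f : Torus d → ℝ} (hf : Smooth f) (v : Vec d) (i : Fin d) :
    HasDerivAt (fun s : ℝ => f (shift (proj v) i s))
      (fderiv ℝ (fun v => f (proj v)) v (EuclideanSpace.single i (1 : ℝ))) 0 := by
  simp only [shift_proj]
  have h1 : HasFDerivAt (fun v => f (proj v)) (fderiv ℝ (fun v => f (proj v)) v)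
      (v + (0 : ℝ) • EuclideanSpace.single i (1 : ℝ)) := by
    rw [zero_smul, add_zero]
    exact (ContDiff.differentiable hf (by simp) v).hasFDerivAt
  have h2 : HasDerivAt (fun s : ℝ => v + s • EuclideanSpace.single i (1 : ℝ))
      (EuclideanSpace.single i (1 : ℝ)) 0 := by
    simpa using ((hasDerivAt_id (0 : ℝ)).smul_const
      (EuclideanSpace.single i (1 : ℝ) : Vec d)).const_add v
  exact h1.comp_hasDerivAt (0 : ℝ) h2

lemma Smooth.pd_proj {f : Torus d → ℝ} (hf : Smooth f) (v : Vec d) (i : Fin d) :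
    pd i f (proj v) =
      fderiv ℝ (fun v => f (proj v)) v (EuclideanSpace.single i (1 : ℝ)) :=
  (hf.hasDerivAt v i).deriv

lemma Smooth.hasDerivAt_shift {f : Torus d → ℝ} (hf : Smooth f) (x : Torus d) (i : Fin d) :
    HasDerivAt (fun s : ℝ => f (shift x i s)) (pd i f x) 0 := by
  obtain ⟨v, rfl⟩ := surjective_proj x
  rw [hf.pd_proj]
  exact hf.hasDerivAt v i

lemma pd_eq_of_hasDerivAt {f : Torus d → ℝ} {x : Torus d} {i : Fin d} {c : ℝ}
    (h : HasDerivAt (fun s : ℝ => f (shift x i s)) c 0) : pd i f x = c := h.deriv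

lemma Smooth.smooth_pd {f : Torus d → ℝ} (hf : Smooth f) (i : Fin d) : Smooth (pd i f) := by
  unfold Smooth
  simp only [hf.pd_proj]
  exact (ContDiff.fderiv_right hf (by simp)).clm_apply contDiff_const

lemma pd_const (c : ℝ) (i : Fin d) (x : Torus d) : pd i (fun _ => c) x = 0 :=
  pd_eq_of_hasDerivAt (hasDerivAt_const _ _)

lemma pd_add {f g : Torus d → ℝ} (hf : Smooth f) (hg : Smooth g) (i : Fin d) (x : Torus d) :
    pd i (fun z => f z + g z) x = pd i f x + pd i g x :=
  pd_eq_of_hasDerivAt ((hf.hasDerivAt_shift x i).add (hg.hasDerivAt_shift x i))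

lemma pd_neg {f : Torus d → ℝ} (hf : Smooth f) (i : Fin d) (x : Torus d) :
    pd i (fun z => -f z) x = -pd i f x :=
  pd_eq_of_hasDerivAt (hf.hasDerivAt_shift x i).neg

lemma pd_mul {f g : Torus d → ℝ} (hf : Smooth f) (hg : Smooth g) (i : Fin d) (x : Torus d) :
    pd i (fun z => f z * g z) x = pd i f x * g x + f x * pd i g x := by
  have h := (hf.hasDerivAt_shift x i).mul (hg.hasDerivAt_shift x i)
  simp only [shift_zero] at h
  exact pd_eq_of_hasDerivAt h

lemma pd_sum {ι : Type*} {s : Finset ι} {f : ι → Torus d → ℝ} (hf : ∀ i ∈ s, Smooth (f i))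
    (i : Fin d) (x : Torus d) :
    pd i (fun z => ∑ j ∈ s, f j z) x = ∑ j ∈ s, pd i (f j) x :=
  pd_eq_of_hasDerivAt (HasDerivAt.fun_sum fun j hj => (hf j hj).hasDerivAt_shift x i)

lemma pd_log {f : Torus d → ℝ} (hf : Smooth f) (h : ∀ x, 0 < f x) (i : Fin d) (x : Torus d) :
    pd i (fun z => Real.log (f z)) x = pd i f x / f x := by
  have h := (hf.hasDerivAt_shift x i).log (by rw [shift_zero]; exact (h x).ne')
  simp only [shift_zero] at h
  exact pd_eq_of_hasDerivAt h

lemma pd_comm {f : Torus d → ℝ} (hf : Smooth f) (i j : Fin d) (x : Torus d) :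
    pd i (pd j f) x = pd j (pd i f) x := by
  obtain ⟨v, rfl⟩ := surjective_proj x
  have hd : DifferentiableAt ℝ (fderiv ℝ fun v => f (proj v)) v :=
    (ContDiff.fderiv_right (m := ∞) hf (by simp)).differentiable (by simp) v
  have key : ∀ i j : Fin d, pd i (pd j f) (proj v) =
      fderiv ℝ (fderiv ℝ fun v => f (proj v)) v (EuclideanSpace.single i 1)
        (EuclideanSpace.single j 1) := by
    intro i j
    rw [(hf.smooth_pd j).pd_proj]
    simp only [hf.pd_proj]
    rw [fderiv_clm_apply hd (differentiableAt_const _)]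
    simp
  rw [key, key]
  exact (ContDiffAt.isSymmSndFDerivAt (ContDiff.contDiffAt hf)
    (by rw [minSmoothness_of_isRCLikeNormedField]; exact WithTop.coe_le_coe.2 le_top)) _ _

lemma Smooth.fderiv_proj {f : Torus d → ℝ} (hf : Smooth f) (v w : Vec d) :
    fderiv ℝ (fun v => f (proj v)) v w = ∑ i, pd i f (proj v) * w i := by
  have hw : w = ∑ i, w i • EuclideanSpace.single i (1 : ℝ) := by
    simpa using ((EuclideanSpace.basisFun (Fin d) ℝ).sum_repr w).symm
  conv_lhs => rw [hw]
  simp only [map_sum, map_smul, hf.pd_proj, smul_eq_mul, mul_comm]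

/-! ### Integration by parts -/

/-- Haar measure is translation invariant, so `∫ f(x + s e_i) dx` does not depend on `s`; its
derivative at `0` is computed under the integral sign. -/
lemma integral_pd {f : Torus d → ℝ} (hf : Smooth f) (i : Fin d) : ∫ x, pd i f x = 0 := by
  obtain ⟨C, -, hC⟩ := (hf.smooth_pd i).exists_bound
  have hderiv : ∀ (x : Torus d) (s : ℝ),
      HasDerivAt (fun s => f (shift x i s)) (pd i f (shift x i s)) s := by
    intro x s
    have h := (hf.hasDerivAt_shift (shift x i s) i)
    have h' : HasDerivAt (fun r : ℝ => f (shift (shift x i s) i (r - s)))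
        (pd i f (shift x i s)) s := by
      refine HasDerivAt.comp_sub_const (f := fun r => f (shift (shift x i s) i r)) s s ?_
      rwa [sub_self]
    refine h'.congr_of_eventuallyEq (Filter.Eventually.of_forall fun r => ?_)
    simp only [shift, add_assoc, ← proj_add, ← add_smul]
    congr 4; ring
  have hcont : ∀ s : ℝ, Continuous fun x : Torus d => shift x i s := fun s =>
    continuous_id.add continuous_const
  have h := hasDerivAt_integral_of_dominated_loc_of_deriv_le (μ := (volume : Measure (Torus d)))
    (F := fun s x => f (shift x i s)) (F' := fun s x => pd i f (shift x i s)) (x₀ := (0 : ℝ))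
    (s := univ) (bound := fun _ => C) Filter.univ_mem
    (Filter.Eventually.of_forall fun s =>
      (hf.continuous.comp (hcont s)).aestronglyMeasurable)
    (by simpa only [shift_zero] using hf.integrable)
    ((hf.smooth_pd i).continuous.comp (hcont 0)).aestronglyMeasurable
    (Filter.Eventually.of_forall fun x s _ => hC _) (integrable_const C)
    (Filter.Eventually.of_forall fun x s _ => hderiv x s)
  have h2 : HasDerivAt (fun s : ℝ => ∫ x : Torus d, f (shift x i s)) 0 0 := by
    simp only [shift, integral_add_right_eq_self]
    exact hasDerivAt_const _ _
  have h3 := h.2.unique h2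
  simpa only [shift_zero] using h3

lemma integral_mul_pd {f g : Torus d → ℝ} (hf : Smooth f) (hg : Smooth g) (i : Fin d) :
    ∫ x, f x * pd i g x = -∫ x, pd i f x * g x := by
  have h := integral_pd (hf.mul hg) i
  simp only [pd_mul hf hg] at h
  rw [integral_add ((hf.smooth_pd i).mul hg).integrable (hf.mul (hg.smooth_pd i)).integrable] at h
  linarith

lemma Smooth.smooth_wLaplacian {a f : Torus d → ℝ} (ha : Smooth a) (hf : Smooth f) :
    Smooth (wLaplacian a f) :=
  Smooth.sum fun i _ => (ha.mul (hf.smooth_pd i)).smooth_pd i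

lemma Smooth.smooth_tangentOf {a f : Torus d → ℝ} (ha : Smooth a) (hf : Smooth f) :
    Smooth (tangentOf a f) := (ha.smooth_wLaplacian hf).neg

/-- The pointwise product `∇ f · ∇ g`. -/
noncomputable def gradDot (f g : Torus d → ℝ) (x : Torus d) : ℝ := ∑ i, pd i f x * pd i g x

lemma Smooth.smooth_gradDot {f g : Torus d → ℝ} (hf : Smooth f) (hg : Smooth g) :
    Smooth (gradDot f g) :=
  Smooth.sum fun i _ => (hf.smooth_pd i).mul (hg.smooth_pd i)

lemma gradDot_comm (f g : Torus d → ℝ) (x : Torus d) : gradDot f g x = gradDot g f x := by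
  simp only [gradDot, mul_comm]

lemma integral_mul_wLaplacian {g a f : Torus d → ℝ} (hg : Smooth g) (ha : Smooth a)
    (hf : Smooth f) :
    ∫ x, g x * wLaplacian a f x = -∫ x, a x * gradDot g f x := by
  simp only [wLaplacian, gradDot, Finset.mul_sum]
  rw [integral_finsetSum _ fun i _ => (hg.mul ((ha.mul (hf.smooth_pd i)).smooth_pd i)).integrable,
    integral_finsetSum _ fun i _ =>
      (ha.mul ((hg.smooth_pd i).mul (hf.smooth_pd i))).integrable,
    ← Finset.sum_neg_distrib]
  refine Finset.sum_congr rfl fun i _ => ?_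
  rw [integral_mul_pd hg (ha.mul (hf.smooth_pd i))]
  congr 1
  refine integral_congr_ae (Filter.Eventually.of_forall fun x => ?_)
  dsimp only
  ring

lemma integral_mul_wLaplacian_comm {g a f : Torus d → ℝ} (hg : Smooth g) (ha : Smooth a)
    (hf : Smooth f) :
    ∫ x, g x * wLaplacian a f x = ∫ x, f x * wLaplacian a g x := by
  rw [integral_mul_wLaplacian hg ha hf, integral_mul_wLaplacian hf ha hg]
  simp only [gradDot_comm g f]

lemma wLaplacian_mem_tangents {a f : Torus d → ℝ} (ha : Smooth a) (hf : Smooth f) :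
    wLaplacian a f ∈ Tangents d := by
  refine ⟨ha.smooth_wLaplacian hf, ?_⟩
  simp only [wLaplacian]
  rw [integral_finsetSum _ fun i _ => ((ha.mul (hf.smooth_pd i)).smooth_pd i).integrable]
  exact Finset.sum_eq_zero fun i _ => integral_pd (ha.mul (hf.smooth_pd i)) i

/-- Serves to pass from weak to pointwise identities: a smooth defect is tested against itself. -/
lemma Smooth.eq_zero_of_integral_sq {f : Torus d → ℝ} (hf : Smooth f)
    (h : ∫ x, f x * f x = 0) (x : Torus d) : f x = 0 := by
  rw [integral_eq_zero_iff_of_nonneg (fun x => mul_self_nonneg (f x)) (hf.mul hf).integrable] at h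
  have h2 := ((hf.mul hf).continuous.ae_eq_iff_eq (μ := (volume : Measure (Torus d)))
    (g := fun _ => (0 : ℝ)) continuous_const).1 h
  exact mul_self_eq_zero.1 (congrFun h2 x)

end TransportNewton

/-! ### Reduction of the Newton flow to a continuity equation. -/

namespace TransportNewton

variable {d : ℕ}

/-! ### The transport Hessian metric in terms of potentials -/

lemma hessApply_comm {h : Torus d → ℝ} (hh : Smooth h) (f g : Torus d → ℝ) (x : Torus d) :
    hessApply h f g x = hessApply h g f x := by
  unfold hessApply
  rw [Finset.sum_comm]
  refine Finset.sum_congr rfl fun j _ => Finset.sum_congr rfl fun i _ => ?_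
  rw [pd_comm hh i j]
  ring

lemma gradDot_gradDot {f g k : Torus d → ℝ} (hf : Smooth f) (hg : Smooth g) (x : Torus d) :
    gradDot (gradDot f g) k x = hessApply f k g x + hessApply g k f x := by
  have h : ∀ i, pd i (gradDot f g) x =
      ∑ j, (pd i (pd j f) x * pd j g x + pd j f x * pd i (pd j g) x) := by
    intro i
    unfold gradDot
    rw [pd_sum fun j _ => (hf.smooth_pd j).mul (hg.smooth_pd j)]
    exact Finset.sum_congr rfl fun j _ => pd_mul (hf.smooth_pd j) (hg.smooth_pd j) i x
  rw [gradDot, hessApply, hessApply, ← Finset.sum_add_distrib]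
  refine Finset.sum_congr rfl fun i _ => ?_
  rw [h i, Finset.sum_mul, ← Finset.sum_add_distrib]
  exact Finset.sum_congr rfl fun j _ => by ring

lemma gradDot_neg_right {g : Torus d → ℝ} (f : Torus d → ℝ) (hg : Smooth g) (x : Torus d) :
    gradDot f (-g) x = -gradDot f g x := by
  have h : ∀ i, pd i (-g) x = -pd i g x := fun i => pd_neg hg i x
  simp only [gradDot, h, mul_neg, Finset.sum_neg_distrib]

lemma inner_grad (f g : Torus d → ℝ) (x : Torus d) :
    inner ℝ (grad f x) (grad g x) = gradDot f g x := by
  simp [grad, gradDot, PiLp.inner_apply, mul_comm]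

/-- Two integrations by parts: the first frees the weight `tangentOf ρ φ`, the second moves the
divergence in that weight onto `∇h · ∇ψ`. The two minus signs of `tangentOf` and `-ψ` cancel. -/
lemma integral_mul_wLaplacian_tangentOf {h ρ φ ψ : Torus d → ℝ} (hh : Smooth h) (hρ : Smooth ρ)
    (hφ : Smooth φ) (hψ : Smooth ψ) :
    ∫ x, h x * wLaplacian (tangentOf ρ φ) (-ψ) x =
      ∫ x, ρ x * gradDot (gradDot h ψ) φ x := by
  have hψ' : Smooth (-ψ) := hψ.neg
  rw [integral_mul_wLaplacian hh (hρ.smooth_tangentOf hφ) hψ']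
  simp only [gradDot_neg_right h hψ, tangentOf, neg_mul_neg, mul_comm (wLaplacian ρ φ _),
    integral_mul_wLaplacian (hh.smooth_gradDot hψ) hρ hφ, neg_neg]

/-- After integration by parts this is the pointwise identity `∇(∇h·∇ψ)·∇φ + ∇(∇h·∇φ)·∇ψ -
∇h·∇(∇φ·∇ψ) = 2 ∇²h(∇φ, ∇ψ)`, in which the Hessians of `φ` and `ψ` cancel by symmetry. -/
lemma integral_mul_christoffel {h ρ φ ψ : Torus d → ℝ} (hh : Smooth h) (hρ : Smooth ρ)
    (hφ : Smooth φ) (hψ : Smooth ψ) :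
    ∫ x, h x * christoffel ρ φ ψ x = -∫ x, hessApply h φ ψ x * ρ x := by
  have hg : (fun z => inner ℝ (grad (-φ) z) (grad (-ψ) z)) = gradDot φ ψ := by
    funext z
    rw [inner_grad, gradDot_neg_right _ hψ, gradDot_comm, gradDot_neg_right _ hφ, neg_neg,
      gradDot_comm]
  have hA : Smooth fun x => h x * wLaplacian (tangentOf ρ φ) (-ψ) x :=
    hh.mul ((hρ.smooth_tangentOf hφ).smooth_wLaplacian hψ.neg)
  have hB : Smooth fun x => h x * wLaplacian (tangentOf ρ ψ) (-φ) x :=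
    hh.mul ((hρ.smooth_tangentOf hψ).smooth_wLaplacian hφ.neg)
  have hC : Smooth fun x => h x * wLaplacian ρ (gradDot φ ψ) x :=
    hh.mul (hρ.smooth_wLaplacian (hφ.smooth_gradDot hψ))
  have h1 : ∫ x, h x * christoffel ρ φ ψ x = -(1 / 2) *
      ((∫ x, h x * wLaplacian (tangentOf ρ φ) (-ψ) x) +
        (∫ x, h x * wLaplacian (tangentOf ρ ψ) (-φ) x) +
        ∫ x, h x * wLaplacian ρ (gradDot φ ψ) x) := by
    rw [← integral_add hA.integrable hB.integrable,
      ← integral_add (hA.add hB).integrable hC.integrable, ← integral_const_mul]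
    refine integral_congr_ae (Filter.Eventually.of_forall fun x => ?_)
    simp only [christoffel, hg]
    ring
  rw [h1, integral_mul_wLaplacian_tangentOf hh hρ hφ hψ,
    integral_mul_wLaplacian_tangentOf hh hρ hψ hφ,
    integral_mul_wLaplacian hh hρ (hφ.smooth_gradDot hψ), ← sub_eq_add_neg,
    ← integral_add (hρ.mul ((hh.smooth_gradDot hψ).smooth_gradDot hφ)).integrable
      (hρ.mul ((hh.smooth_gradDot hφ).smooth_gradDot hψ)).integrable,
    ← integral_sub ((hρ.mul ((hh.smooth_gradDot hψ).smooth_gradDot hφ)).add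
      (hρ.mul ((hh.smooth_gradDot hφ).smooth_gradDot hψ))).integrable
      (hρ.mul (hh.smooth_gradDot (hφ.smooth_gradDot hψ))).integrable,
    ← integral_const_mul, ← integral_neg]
  refine integral_congr_ae (Filter.Eventually.of_forall fun x => ?_)
  simp only [gradDot_comm h (gradDot φ ψ), gradDot_gradDot hφ hψ, gradDot_gradDot hh hψ,
    gradDot_gradDot hh hφ, hessApply_comm hh ψ φ x, hessApply_comm hψ φ h x,
    hessApply_comm hφ ψ h x]
  ring

/-- Absorbs the sign between `tangentOf` and `wLaplacian`. Reflecting both parameters about `0`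
suffices; `deriv_comp_neg` needs no differentiability, so nothing is asked of `E`. -/
lemma secondVariation_neg (E : (Torus d → ℝ) → ℝ) (ρ σ τ : Torus d → ℝ) :
    secondVariation E ρ (-σ) (-τ) = secondVariation E ρ σ τ := by
  unfold secondVariation
  have h1 : ∀ s : ℝ, deriv (fun t : ℝ => E (ρ + t • (-σ) + s • (-τ))) 0 =
      -deriv (fun t : ℝ => E (ρ + t • σ + (-s) • τ)) 0 := by
    intro s
    have := deriv_comp_neg (fun t : ℝ => E (ρ + t • σ + (-s) • τ)) 0
    simpa only [smul_neg, neg_smul, neg_zero] using this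
  simp only [h1]
  have h2 := deriv_comp_neg (fun s : ℝ => -deriv (fun t : ℝ => E (ρ + t • σ + s • τ)) 0) 0
  simp only [neg_zero] at h2
  rw [h2, deriv.fun_neg, neg_neg]

lemma hessianMetric_eq_kernelH {E : (Torus d → ℝ) → ℝ} {ρ φ ψ : Torus d → ℝ}
    (hh : Smooth (firstVariation E ρ)) (hρ : Smooth ρ) (hφ : Smooth φ) (hψ : Smooth ψ) :
    hessianMetric E ρ φ ψ = kernelH E ρ φ ψ := by
  rw [hessianMetric, kernelH, integral_mul_christoffel hh hρ hφ hψ, sub_neg_eq_add,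
    ← secondVariation_neg E ρ (wLaplacian ρ φ)]
  rfl

/-- Symmetry of `Δ_ρ` frees the test potential `Ψ`, and the gradient condition becomes the linear
equation `H Φ = -Δ_ρ δE(ρ)`, to which the inverse kernel applies. -/
lemma isGradientPotential_iff {E : (Torus d → ℝ) → ℝ} {ρ Φ : Torus d → ℝ}
    (hh : Smooth (firstVariation E ρ)) (hρ : Smooth ρ) (hΦ : Smooth Φ) :
    IsGradientPotential E E ρ Φ ↔ ∀ Ψ, Smooth Ψ →
      kernelH E ρ Ψ Φ = ∫ x, Ψ x * tangentOf ρ (firstVariation E ρ) x := by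
  refine ⟨fun H Ψ hΨ => ?_, fun H => ⟨hΦ, fun Ψ hΨ => ?_⟩⟩
  all_goals
    have key : ∫ x, firstVariation E ρ x * tangentOf ρ Ψ x =
        ∫ x, Ψ x * tangentOf ρ (firstVariation E ρ) x := by
      simp only [tangentOf, mul_neg, integral_neg]
      rw [integral_mul_wLaplacian_comm hh hρ hΨ]
  · rw [← hessianMetric_eq_kernelH hh hρ hΨ hΦ, H.2 Ψ hΨ, key]
  · rw [hessianMetric_eq_kernelH hh hρ hΨ hΦ, H Ψ hΨ, key]

/-! ### The drift -/

lemma IsFirstVariation.firstVariation {E : (Torus d → ℝ) → ℝ} {ρ : Torus d → ℝ}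
    (h : ∃ h, IsFirstVariation E ρ h) : IsFirstVariation E ρ (firstVariation E ρ) := by
  rw [TransportNewton.firstVariation, dif_pos h]
  exact h.choose_spec

lemma integral_densityMeasure {F : Type*} [NormedAddCommGroup F] [NormedSpace ℝ F]
    {ρ : Torus d → ℝ} (hρ : Smooth ρ) (h0 : ∀ x, 0 < ρ x) (G : Torus d → F) :
    ∫ x, G x ∂(densityMeasure ρ) = ∫ x, ρ x • G x := by
  rw [densityMeasure, integral_withDensity_eq_integral_toReal_smul
    hρ.continuous.measurable.ennreal_ofReal (Filter.Eventually.of_forall fun _ => by simp)]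
  simp only [ENNReal.toReal_ofReal (h0 _).le]

lemma integrable_mul_smooth {k f : Torus d → ℝ} (hk : Integrable k) (hf : Smooth f) :
    Integrable fun x => k x * f x := by
  obtain ⟨C, -, hC⟩ := hf.exists_bound
  exact hk.mul_bdd hf.continuous.aestronglyMeasurable (c := C)
    (Filter.Eventually.of_forall hC)

lemma integral_vec_apply {F : Torus d → Vec d} (h : ∀ i, Integrable fun y => F y i) (i : Fin d) :
    (∫ y, F y) i = ∫ y, F y i := by
  have hF : Integrable F := Integrable.of_eval_piLp h
  exact ((EuclideanSpace.proj i : Vec d →L[ℝ] ℝ).integral_comp_comm hF).symm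

lemma applyKernel_sum {ι : Type*} {s : Finset ι} {K : Torus d → Torus d → ℝ}
    (hK : ∀ x, Integrable (K x)) {g : ι → Torus d → ℝ} (hg : ∀ j ∈ s, Smooth (g j))
    (x : Torus d) :
    applyKernel K (fun y => ∑ j ∈ s, g j y) x = ∑ j ∈ s, applyKernel K (g j) x := by
  simp only [applyKernel, Finset.mul_sum]
  exact integral_finsetSum _ fun j hj => integrable_mul_smooth (hK x) (hg j hj)

/-- `∑ j, ∫ N i j φ_j = -∂_i ∫ K (∇ · φ)`. -/
lemma IsGradGrad.sum_integral {K : Torus d → Torus d → ℝ}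
    {N : Torus d → Torus d → Matrix (Fin d) (Fin d) ℝ} (hN : IsGradGrad K N)
    (hK : ∀ x, Integrable (K x)) {φ : Fin d → Torus d → ℝ} (hφ : ∀ j, Smooth (φ j))
    (x : Torus d) (i : Fin d) :
    HasDerivAt (fun s : ℝ => applyKernel K (fun y => ∑ j, pd j (φ j) y) (shift x i s))
      (-∑ j, ∫ y, N x y i j * φ j y) 0 := by
  simp only [applyKernel_sum hK fun j _ => (hφ j).smooth_pd j]
  rw [← Finset.sum_neg_distrib]
  exact HasDerivAt.fun_sum fun j _ => hN.deriv x i j (φ j) (hφ j)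

lemma expectGrad_apply {K : Torus d → Torus d → ℝ}
    {N : Torus d → Torus d → Matrix (Fin d) (Fin d) ℝ} (hN : IsGradGrad K N)
    {ρ h : Torus d → ℝ} (hρ : Smooth ρ) (h0 : ∀ x, 0 < ρ x) (hh : Smooth h)
    (x : Torus d) (i : Fin d) :
    expectGrad N ρ h x i = ∑ j, ∫ y, N x y i j * (ρ y * pd j h y) := by
  have hc : ∀ (y : Torus d) (k : Fin d),
      (ρ y • WithLp.toLp 2 (Matrix.mulVec (N x y) (grad h y).ofLp) : Vec d) k =
        ∑ j, N x y k j * (ρ y * pd j h y) := by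
    intro y k
    simp only [PiLp.smul_apply, Matrix.mulVec, dotProduct, grad, smul_eq_mul, Finset.mul_sum]
    exact Finset.sum_congr rfl fun j _ => by ring
  have hi : ∀ k j, Integrable fun y => N x y k j * (ρ y * pd j h y) := fun k j =>
    integrable_mul_smooth (hN.integrable x k j) (hρ.mul (hh.smooth_pd j))
  rw [expectGrad, integral_densityMeasure hρ h0, integral_vec_apply]
  · simp only [hc]
    exact integral_finsetSum _ fun j _ => hi i j
  · intro k
    simp only [hc]
    exact integrable_finsetSum _ fun j _ => hi k j

/-- The potential of the Newton drift. -/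
noncomputable def newtonPotential (E : (Torus d → ℝ) → ℝ) (K : Torus d → Torus d → ℝ)
    (ρ : Torus d → ℝ) : Torus d → ℝ :=
  applyKernel K (wLaplacian ρ (firstVariation E ρ))

/-- `∇_x ∇_y K` is a distributional derivative in `y`, so pairing it with `ρ ∇ δE` gives `-∇_x` of
`K` paired with `∇ · (ρ ∇ δE)`. -/
lemma newtonDrift_eq_grad {E : (Torus d → ℝ) → ℝ}
    {K : (Torus d → ℝ) → Torus d → Torus d → ℝ}
    {N : (Torus d → ℝ) → Torus d → Torus d → Matrix (Fin d) (Fin d) ℝ}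
    {ρ : Torus d → ℝ} (hρ : ρ ∈ Densities d) (hh : Smooth (firstVariation E ρ))
    (hK : ∀ x, Integrable (K ρ x)) (hN : IsGradGrad (K ρ) (N ρ)) (x : Torus d) :
    newtonDrift E N ρ x = grad (newtonPotential E (K ρ) ρ) x := by
  ext i
  rw [newtonDrift, PiLp.neg_apply, expectGrad_apply hN hρ.1 hρ.2.1 hh]
  exact (pd_eq_of_hasDerivAt
    (hN.sum_integral hK (fun j => hρ.1.mul (hh.smooth_pd j)) x i)).symm

/-! ### Gradient potentials and the continuity equation. -/

lemma applyKernel_neg (K : Torus d → Torus d → ℝ) (g : Torus d → ℝ) (x : Torus d) :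
    applyKernel K (fun y => -g y) x = -applyKernel K g x := by
  simp only [applyKernel, mul_neg, integral_neg]

lemma pd_add_const {f : Torus d → ℝ} (hf : Smooth f) (c : ℝ) (i : Fin d) (x : Torus d) :
    pd i (fun z => f z + c) x = pd i f x := by
  rw [pd_add hf (smooth_const c), pd_const, add_zero]

/-- A gradient potential has gradient opposite to the Newton drift. -/
lemma IsGradientPotential.pd_eq {E : (Torus d → ℝ) → ℝ} {K : Torus d → Torus d → ℝ}
    {ρ Φ : Torus d → ℝ} (hρ : ρ ∈ Densities d) (hh : Smooth (firstVariation E ρ))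
    (hK : IsInverseKernel E ρ K) (hΦ : IsGradientPotential E E ρ Φ) (i : Fin d) :
    pd i Φ = fun x => -pd i (newtonPotential E K ρ) x := by
  obtain ⟨c, hc⟩ := hK.left_inv Φ _ hΦ.1 (hρ.1.smooth_tangentOf hh)
    ((isGradientPotential_iff hh hρ.1 hΦ.1).1 hΦ)
  have hu : Smooth (newtonPotential E K ρ) :=
    hK.right_smooth _ (wLaplacian_mem_tangents hρ.1 hh)
  have h : (fun x => -newtonPotential E K ρ x) = fun x => Φ x + c := by
    funext x
    rw [← hc x]
    exact (applyKernel_neg K _ x).symm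
  funext x
  rw [← pd_add_const hΦ.1 c i x, ← h, pd_neg hu]

lemma isGradientPotential_neg_newtonPotential {E : (Torus d → ℝ) → ℝ}
    {K : Torus d → Torus d → ℝ} {ρ : Torus d → ℝ} (hρ : ρ ∈ Densities d)
    (hh : Smooth (firstVariation E ρ)) (hK : IsInverseKernel E ρ K) :
    IsGradientPotential E E ρ fun x => -newtonPotential E K ρ x := by
  have hu : Smooth (newtonPotential E K ρ) :=
    hK.right_smooth _ (wLaplacian_mem_tangents hρ.1 hh)
  have hg : tangentOf ρ (firstVariation E ρ) ∈ Tangents d := by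
    obtain ⟨h1, h2⟩ := wLaplacian_mem_tangents hρ.1 hh
    refine ⟨h1.neg, ?_⟩
    simp only [tangentOf, integral_neg, h2, neg_zero]
  have he : (fun x => -newtonPotential E K ρ x) =
      applyKernel K (tangentOf ρ (firstVariation E ρ)) := by
    funext x
    exact (applyKernel_neg K _ x).symm
  rw [isGradientPotential_iff hh hρ.1 hu.neg, he]
  exact fun Ψ hΨ => hK.right_inv _ hg Ψ hΨ

/-- The continuity equation `∂_t ρ + ∇ · (ρ V) = 0` on `[0,T]`. -/
def ContinuityEq (T : ℝ) (ρ : ℝ → Torus d → ℝ) (V : ℝ → Torus d → Vec d) : Prop :=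
  ∀ t ∈ Icc (0 : ℝ) T, ∀ x, HasDerivWithinAt (fun s => ρ s x)
    (-∑ i, pd i (fun z => ρ t z * V t z i) x) (Icc 0 T) t

/-- The left inverse forces `∇Φ = -V` for any gradient potential, and the right inverse shows that
`-newtonPotential` is one. Since only `∇Φ` enters the smoothness condition and the evolution
equation, the free constant in `Φ` is harmless. -/
theorem isNewtonFlow_iff {E : (Torus d → ℝ) → ℝ} {T : ℝ} {ρ : ℝ → Torus d → ℝ}
    {K : (Torus d → ℝ) → Torus d → Torus d → ℝ}
    {N : (Torus d → ℝ) → Torus d → Torus d → Matrix (Fin d) (Fin d) ℝ}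
    (hρ : IsDensityCurve T ρ) (hh : ∀ t ∈ Icc (0 : ℝ) T, Smooth (firstVariation E (ρ t)))
    (hN : ∀ t ∈ Icc (0 : ℝ) T, IsGradGrad (K (ρ t)) (N (ρ t)))
    (hK : ∀ t ∈ Icc (0 : ℝ) T, IsInverseKernel E (ρ t) (K (ρ t))) :
    IsNewtonFlow E T ρ ↔ SmoothOnCylinder T (fun t => newtonDrift E N (ρ t)) ∧
      ContinuityEq T ρ fun t => newtonDrift E N (ρ t) := by
  have hV : ∀ t ∈ Icc (0 : ℝ) T, ∀ x, newtonDrift E N (ρ t) x =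
      grad (newtonPotential E (K (ρ t)) (ρ t)) x := fun t ht =>
    newtonDrift_eq_grad (hρ.2 t ht) (hh t ht) (hK t ht).integrable (hN t ht)
  have hu : ∀ t ∈ Icc (0 : ℝ) T, Smooth (newtonPotential E (K (ρ t)) (ρ t)) := fun t ht =>
    (hK t ht).right_smooth _ (wLaplacian_mem_tangents (hρ.2 t ht).1 (hh t ht))
  have hdiv : ∀ t ∈ Icc (0 : ℝ) T, ∀ Φ : Torus d → ℝ,
      (∀ i, pd i Φ = fun x => -pd i (newtonPotential E (K (ρ t)) (ρ t)) x) → ∀ x,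
      -tangentOf (ρ t) Φ x = -∑ i, pd i (fun z => ρ t z * newtonDrift E N (ρ t) z i) x := by
    intro t ht Φ hΦ x
    have hr : Smooth (ρ t) := (hρ.2 t ht).1
    simp only [tangentOf, neg_neg, wLaplacian, hΦ, hV t ht, grad, mul_neg,
      pd_neg (hr.mul ((hu t ht).smooth_pd _)), Finset.sum_neg_distrib]
  constructor
  · rintro ⟨-, Φ, hΦs, hΦ⟩
    have hpd : ∀ t ∈ Icc (0 : ℝ) T, ∀ i,
        pd i (Φ t) = fun x => -pd i (newtonPotential E (K (ρ t)) (ρ t)) x := fun t ht =>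
      (hΦ t ht).1.pd_eq (hρ.2 t ht) (hh t ht) (hK t ht)
    refine ⟨?_, fun t ht x => ?_⟩
    · refine (ContDiffOn.neg hΦs).congr fun p hp => ?_
      ext i
      simp [hV p.1 hp.1, grad, hpd p.1 hp.1]
    · rw [← hdiv t ht (Φ t) (hpd t ht) x]
      exact (hΦ t ht).2 x
  · rintro ⟨hs, hc⟩
    have hpd : ∀ t ∈ Icc (0 : ℝ) T, ∀ i,
        pd i (fun x => -newtonPotential E (K (ρ t)) (ρ t) x) =
          fun x => -pd i (newtonPotential E (K (ρ t)) (ρ t)) x := fun t ht i =>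
      funext fun x => pd_neg (hu t ht) i x
    refine ⟨hρ, fun t x => -newtonPotential E (K (ρ t)) (ρ t) x, ?_, fun t ht => ⟨?_, fun x => ?_⟩⟩
    · refine (ContDiffOn.neg hs).congr fun p hp => ?_
      ext i
      simp [hV p.1 hp.1, grad, hpd p.1 hp.1]
    · exact isGradientPotential_neg_newtonPotential (hρ.2 t ht) (hh t ht) (hK t ht)
    · rw [hdiv t ht _ (hpd t ht) x]
      exact hc t ht x

end TransportNewton

/-! ### Explicit drift for the relative entropy. -/

namespace TransportNewton

variable {d : ℕ}

/-! ### The Kullback-Leibler divergence -/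

lemma exists_pos_lower_bound {ρ : Torus d → ℝ} (hρ : Smooth ρ) (h0 : ∀ x, 0 < ρ x) :
    ∃ m, 0 < m ∧ ∀ x, m ≤ ρ x := by
  obtain ⟨x, -, hx⟩ := (isCompact_univ (X := Torus d)).exists_isMinOn univ_nonempty
    hρ.continuous.continuousOn
  exact ⟨ρ x, h0 x, fun y => hx (mem_univ y)⟩

/-- On the compact torus `ρ` is bounded away from zero, so `ρ + ε σ` stays in a fixed compact subset
of `(0, ∞)` for small `ε`, where `r log r` is smooth; dominated differentiation applies. -/
lemma isFirstVariation_klEnergy {f ρ : Torus d → ℝ} (hf : Smooth f) (hρ : ρ ∈ Densities d) :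
    IsFirstVariation (klEnergy f) ρ fun x => Real.log (ρ x) + f x + 1 := by
  obtain ⟨hr, h0, -⟩ := hρ
  refine ⟨((hr.log h0).add hf).add (smooth_const 1), fun σ hσ => ?_⟩
  obtain ⟨m, hm, hmρ⟩ := exists_pos_lower_bound hr h0
  obtain ⟨C, hC0, hC⟩ := hσ.1.exists_bound
  obtain ⟨R, -, hR⟩ := hr.exists_bound
  obtain ⟨B, hB0, hB⟩ := hf.exists_bound
  -- Chosen so that `|ε σ| ≤ m / 2` when `|ε| < δ`; the `+ 1` covers `C = 0`.
  set δ : ℝ := m / (2 * (C + 1)) with hδ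
  have hδ0 : 0 < δ := by positivity
  have hsmall : ∀ ε ∈ Metric.ball (0 : ℝ) δ, ∀ x, |ε * σ x| ≤ m / 2 := by
    intro ε hε x
    rw [mem_ball_zero_iff, Real.norm_eq_abs] at hε
    rw [abs_mul]
    calc |ε| * |σ x| ≤ δ * (C + 1) :=
          mul_le_mul hε.le ((hC x).trans (by linarith)) (abs_nonneg _) hδ0.le
      _ = m / 2 := by rw [hδ]; field_simp
  have hlow : ∀ ε ∈ Metric.ball (0 : ℝ) δ, ∀ x, m / 2 ≤ ρ x + ε * σ x := by
    intro ε hε x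
    have h1 := (abs_le.1 (hsmall ε hε x)).1
    linarith [hmρ x]
  have hpos : ∀ ε ∈ Metric.ball (0 : ℝ) δ, ∀ x, 0 < ρ x + ε * σ x := fun ε hε x =>
    (half_pos hm).trans_le (hlow ε hε x)
  have hlog : ∀ ε ∈ Metric.ball (0 : ℝ) δ, ∀ x,
      |Real.log (ρ x + ε * σ x)| ≤ |Real.log (m / 2)| + |Real.log (R + m / 2)| := by
    intro ε hε x
    have h1 := Real.log_le_log (half_pos hm) (hlow ε hε x)
    have h2 := Real.log_le_log (hpos ε hε x) (y := R + m / 2)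
      (by linarith [(abs_le.1 (hsmall ε hε x)).2, (abs_le.1 (hR x)).2])
    rw [abs_le]
    constructor
    · linarith [neg_abs_le (Real.log (m / 2)), abs_nonneg (Real.log (R + m / 2))]
    · linarith [le_abs_self (Real.log (R + m / 2)), abs_nonneg (Real.log (m / 2))]
  have h0δ : (0 : ℝ) ∈ Metric.ball (0 : ℝ) δ := Metric.mem_ball_self hδ0
  have hsmooth : ∀ ε ∈ Metric.ball (0 : ℝ) δ,
      Smooth fun x => (ρ x + ε * σ x) * (Real.log (ρ x + ε * σ x) + f x) := by
    intro ε hε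
    have h1 : Smooth fun x => ρ x + ε * σ x := hr.add ((smooth_const ε).mul hσ.1)
    exact h1.mul ((h1.log (hpos ε hε)).add hf)
  have hnhds : Metric.ball (0 : ℝ) δ ∈ nhds (0 : ℝ) := Metric.ball_mem_nhds _ hδ0
  have key := hasDerivAt_integral_of_dominated_loc_of_deriv_le
    (μ := (volume : Measure (Torus d)))
    (F := fun ε x => (ρ x + ε * σ x) * (Real.log (ρ x + ε * σ x) + f x))
    (F' := fun ε x => (Real.log (ρ x + ε * σ x) + f x + 1) * σ x) (x₀ := (0 : ℝ))
    (bound := fun _ => (|Real.log (m / 2)| + |Real.log (R + m / 2)| + B + 1) * C) hnhds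
    (Filter.eventually_of_mem hnhds fun ε hε => (hsmooth ε hε).continuous.aestronglyMeasurable)
    (hsmooth 0 h0δ).integrable
    (by
      simp only [zero_mul, add_zero]
      exact ((((hr.log h0).add hf).add (smooth_const 1)).mul
        hσ.1).continuous.aestronglyMeasurable)
    (Filter.Eventually.of_forall fun x ε hε => by
      rw [Real.norm_eq_abs, abs_mul]
      refine mul_le_mul ?_ (hC x) (abs_nonneg _) (by positivity)
      calc |Real.log (ρ x + ε * σ x) + f x + 1|
          ≤ |Real.log (ρ x + ε * σ x)| + |f x| + |(1 : ℝ)| := abs_add_three _ _ _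
        _ ≤ _ := by
            rw [abs_one]
            linarith [hlog ε hε x, hB x])
    (integrable_const _)
    (Filter.Eventually.of_forall fun x ε hε => by
      have h1 : HasDerivAt (fun ε : ℝ => ρ x + ε * σ x) (σ x) ε := by
        simpa using ((hasDerivAt_id ε).mul_const (σ x)).const_add (ρ x)
      have hne := (hpos ε hε x).ne'
      have h2 := h1.mul ((h1.log hne).add_const (f x))
      rw [mul_div_cancel₀ _ hne] at h2
      exact h2.congr_deriv (by ring))
  have h2 := key.2
  simp only [zero_mul, add_zero] at h2
  refine h2.congr_of_eventuallyEq (Filter.eventually_of_mem hnhds fun ε hε => ?_)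
  refine integral_congr_ae (Filter.Eventually.of_forall fun x => ?_)
  simp only [Pi.add_apply, Pi.smul_apply, smul_eq_mul]
  rw [Real.log_div (hpos ε hε x).ne' (Real.exp_ne_zero _), Real.log_exp, sub_neg_eq_add]

/-- The first variation is determined up to a constant. -/
lemma IsFirstVariation.pd_eq {E : (Torus d → ℝ) → ℝ} {ρ h₁ h₂ : Torus d → ℝ}
    (H₁ : IsFirstVariation E ρ h₁) (H₂ : IsFirstVariation E ρ h₂) (i : Fin d) (x : Torus d) :
    pd i h₁ x = pd i h₂ x := by
  set g : Torus d → ℝ := fun x => h₁ x - h₂ x with hg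
  have hgs : Smooth g := H₁.1.sub H₂.1
  set c : ℝ := ∫ x, g x with hc
  -- Only directions of zero integral are available, so the difference `g` is tested against itself
  -- minus its mean.
  have hσ : (fun x => g x - c) ∈ Tangents d := by
    refine ⟨hgs.sub (smooth_const c), ?_⟩
    rw [integral_sub hgs.integrable (integrable_const c)]
    simp [hc]
  have h1 : ∫ x, g x * (g x - c) = 0 := by
    have := (H₁.2 _ hσ).unique (H₂.2 _ hσ)
    simp only [hg, sub_mul]
    rw [integral_sub (H₁.1.mul hσ.1).integrable (H₂.1.mul hσ.1).integrable]
    exact sub_eq_zero.2 this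
  have h2 : ∫ x, (g x - c) * (g x - c) = 0 := by
    have : ∀ x, (g x - c) * (g x - c) = g x * (g x - c) - c * (g x - c) := fun x => by ring
    simp only [this]
    rw [integral_sub (hgs.mul hσ.1).integrable ((smooth_const c).mul hσ.1).integrable, h1,
      integral_const_mul, hσ.2]
    simp
  have h3 : h₁ = fun x => h₂ x + c := by
    funext y
    have := hσ.1.eq_zero_of_integral_sq h2 y
    simp only [hg] at this
    linarith
  rw [h3, pd_add_const H₂.1]

/-- Here `ρ ∇ δE = ρ ∇f + ∇ρ`. The second term, paired with `∇_x ∇_y K`, and `∇_x Δ_y K` paired with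
`ρ` are, up to sign, the same derivative `∂_i ∫ K Δρ`; uniqueness of derivatives identifies them. -/
lemma newtonDrift_klEnergy {f ρ : Torus d → ℝ} (hf : Smooth f) (hρ : ρ ∈ Densities d)
    {K : (Torus d → ℝ) → Torus d → Torus d → ℝ}
    {N : (Torus d → ℝ) → Torus d → Torus d → Matrix (Fin d) (Fin d) ℝ}
    {L : (Torus d → ℝ) → Torus d → Torus d → Vec d}
    (hK : ∀ x, Integrable (K ρ x)) (hN : IsGradGrad (K ρ) (N ρ))
    (hL : IsGradLaplacian (K ρ) (L ρ)) (x : Torus d) :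
    newtonDrift (klEnergy f) N ρ x = klDrift f N L ρ x := by
  have hv := isFirstVariation_klEnergy hf hρ
  have hv' := IsFirstVariation.firstVariation ⟨_, hv⟩
  obtain ⟨hr, h0, -⟩ := hρ
  have hpd : ∀ j y, ρ y * pd j (firstVariation (klEnergy f) ρ) y =
      ρ y * pd j f y + pd j ρ y := by
    intro j y
    have hne := (h0 y).ne'
    rw [hv'.pd_eq hv, pd_add_const ((hr.log h0).add hf), pd_add (hr.log h0) hf, pd_log hr h0]
    field_simp
    ring
  ext i
  have hLi : (∫ y, L ρ x y ∂(densityMeasure ρ)) i = ∫ y, L ρ x y i * ρ y := by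
    have hc : ∀ (y : Torus d) (k : Fin d), (ρ y • L ρ x y) k = L ρ x y k * ρ y := fun y k => by
      rw [PiLp.smul_apply, smul_eq_mul, mul_comm]
    rw [integral_densityMeasure hr h0, integral_vec_apply]
    · simp only [hc]
    · intro k
      simp only [hc]
      exact integrable_mul_smooth (hL.integrable x k) hr
  have hLap : ∫ y, L ρ x y i * ρ y = -∑ j, ∫ y, N ρ x y i j * pd j ρ y :=
    (hL.deriv x i ρ hr).unique (hN.sum_integral hK (fun j => hr.smooth_pd j) x i)
  rw [newtonDrift, klDrift, PiLp.add_apply, PiLp.neg_apply, PiLp.neg_apply, hLi, hLap,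
    expectGrad_apply hN hr h0 hv'.1, expectGrad_apply hN hr h0 hf, ← neg_add,
    ← Finset.sum_add_distrib]
  congr 1
  refine Finset.sum_congr rfl fun j _ => ?_
  simp only [hpd, mul_add]
  exact integral_add (integrable_mul_smooth (hN.integrable x i j) (hr.mul (hf.smooth_pd j)))
    (integrable_mul_smooth (hN.integrable x i j) (hr.smooth_pd j))

end TransportNewton

/-! ### Uniform estimates on the cylinder. -/

open scoped Pointwise

namespace TransportNewton

variable {d : ℕ} {F : Type*} [NormedAddCommGroup F] [NormedSpace ℝ F]

/-! ### Bounds for smooth functions on the cylinder -/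

/-- Functions on `ℝ × ℝ^d` which are periodic in the second variable. -/
def PeriodicSnd {G : Type*} (g : ℝ × Vec d → G) : Prop :=
  ∀ δ : Vec d, proj δ = 0 → ∀ p, g (p + (0, δ)) = g p

lemma periodicSnd_comp_proj {G : Type*} (V : ℝ → Torus d → G) :
    PeriodicSnd fun p : ℝ × Vec d => V p.1 (proj p.2) := by
  intro δ hδ p
  simp [proj_add, hδ]

lemma uniqueDiffOn_cylinder {T : ℝ} (hT : 0 < T) :
    UniqueDiffOn ℝ (Icc 0 T ×ˢ (univ : Set (Vec d))) :=
  (uniqueDiffOn_Icc hT).prod uniqueDiffOn_univ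

/-- Every point can be translated by a period into `[0,T]` times a ball containing the unit cube,
which is compact. -/
lemma PeriodicSnd.exists_bound {G : Type*} [NormedAddCommGroup G] {T : ℝ} {g : ℝ × Vec d → G} (hp : PeriodicSnd g)
    (hg : ContinuousOn g (Icc 0 T ×ˢ univ)) :
    ∃ C, 0 ≤ C ∧ ∀ p ∈ Icc 0 T ×ˢ (univ : Set (Vec d)), ‖g p‖ ≤ C := by
  obtain ⟨C, hC⟩ := ((isCompact_Icc (a := (0 : ℝ)) (b := T)).prod
    (isCompact_closedBall (0 : Vec d) (Real.sqrt d))).exists_bound_of_continuousOn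
    (hg.mono (prod_mono_right (subset_univ _)))
  refine ⟨max C 0, le_max_right _ _, fun p hpS => le_max_of_le_left ?_⟩
  have h1 := hp (liftCube (proj p.2) - p.2) (by rw [proj_sub, proj_liftCube, sub_self]) p
  rw [← h1]
  refine hC _ ⟨by simpa using hpS.1, ?_⟩
  simpa using norm_liftCube_le (proj p.2)

lemma PeriodicSnd.fderivWithin {T : ℝ} {g : ℝ × Vec d → F} (hp : PeriodicSnd g) :
    PeriodicSnd (fderivWithin ℝ g (Icc 0 T ×ˢ univ)) := by
  intro δ hδ p
  have h1 := fderivWithin_comp_add_right (𝕜 := ℝ) (f := g) (s := Icc 0 T ×ˢ univ) (x := p)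
    ((0, δ) : ℝ × Vec d)
  have h2 : ((0, δ) : ℝ × Vec d) +ᵥ (Icc 0 T ×ˢ (univ : Set (Vec d))) = Icc 0 T ×ˢ univ := by
    ext q
    simp [mem_vadd_set_iff_neg_vadd_mem]
  rw [h2] at h1
  rw [← h1]
  congr 1
  exact funext (hp δ hδ)

lemma PeriodicSnd.exists_lipschitz {T : ℝ} (hT : 0 < T) {g : ℝ × Vec d → F} (hp : PeriodicSnd g)
    (hg : ContDiffOn ℝ ∞ g (Icc 0 T ×ˢ univ)) :
    ∃ C, 0 ≤ C ∧ ∀ p ∈ Icc 0 T ×ˢ (univ : Set (Vec d)), ∀ q ∈ Icc 0 T ×ˢ (univ : Set (Vec d)),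
      ‖g p - g q‖ ≤ C * ‖p - q‖ := by
  obtain ⟨C, hC0, hC⟩ := (hp.fderivWithin (T := T)).exists_bound
    (hg.continuousOn_fderivWithin (uniqueDiffOn_cylinder hT) (by simp))
  refine ⟨C, hC0, fun p hpS q hqS => ?_⟩
  exact Convex.norm_image_sub_le_of_norm_fderivWithin_le (hg.differentiableOn (by simp)) hC
    ((convex_Icc 0 T).prod convex_univ) hqS hpS

/-- The one-sided time derivative at time `t` of a function on `[0,T] × M`. -/
noncomputable def timeDeriv (T : ℝ) (V : ℝ → Torus d → F) (t : ℝ) (x : Torus d) : F :=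
  derivWithin (fun s => V s x) (Icc 0 T) t

section

variable {T : ℝ} {V : ℝ → Torus d → F}

lemma SmoothOnCylinder.slice (hV : SmoothOnCylinder T V) {t : ℝ} (ht : t ∈ Icc 0 T) :
    ContDiff ℝ ∞ fun v : Vec d => V t (proj v) := by
  rw [← contDiffOn_univ]
  exact ContDiffOn.comp (g := fun p : ℝ × Vec d => V p.1 (proj p.2))
    (f := fun v : Vec d => (t, v)) hV (contDiff_const.prodMk contDiff_id).contDiffOn
    fun v _ => ⟨ht, mem_univ _⟩

lemma SmoothOnCylinder.hasFDerivWithinAt (hV : SmoothOnCylinder T V) {t : ℝ} (ht : t ∈ Icc 0 T)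
    (v : Vec d) :
    HasFDerivWithinAt (fun p : ℝ × Vec d => V p.1 (proj p.2))
      (fderivWithin ℝ (fun p : ℝ × Vec d => V p.1 (proj p.2)) (Icc 0 T ×ˢ univ) (t, v))
      (Icc 0 T ×ˢ univ) (t, v) :=
  (ContDiffOn.differentiableOn hV (by simp) (t, v) ⟨ht, mem_univ _⟩).hasFDerivWithinAt

lemma SmoothOnCylinder.fderiv_slice (hV : SmoothOnCylinder T V) {t : ℝ} (ht : t ∈ Icc 0 T)
    (v : Vec d) :
    fderiv ℝ (fun v : Vec d => V t (proj v)) v =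
      (fderivWithin ℝ (fun p : ℝ × Vec d => V p.1 (proj p.2)) (Icc 0 T ×ˢ univ) (t, v)).comp
        (ContinuousLinearMap.inr ℝ ℝ (Vec d)) := by
  have h := (hV.hasFDerivWithinAt ht v).comp v (s := univ) (f := fun v : Vec d => (t, v))
    (hasFDerivAt_prodMk_right t v).hasFDerivWithinAt fun v _ => ⟨ht, mem_univ _⟩
  rw [hasFDerivWithinAt_univ] at h
  exact h.fderiv

lemma SmoothOnCylinder.hasDerivWithinAt_aux (hV : SmoothOnCylinder T V) {t : ℝ}
    (ht : t ∈ Icc 0 T) (v : Vec d) :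
    HasDerivWithinAt (fun s => V s (proj v))
      (fderivWithin ℝ (fun p : ℝ × Vec d => V p.1 (proj p.2)) (Icc 0 T ×ˢ univ) (t, v) (1, 0))
      (Icc 0 T) t := by
  have h := (hV.hasFDerivWithinAt ht v).comp t (s := Icc 0 T) (f := fun s : ℝ => (s, v))
    (hasFDerivAt_prodMk_left t v).hasFDerivWithinAt fun s hs => ⟨hs, mem_univ _⟩
  simpa [Function.comp_def] using h.hasDerivWithinAt

lemma SmoothOnCylinder.timeDeriv_eq (hT : 0 < T) (hV : SmoothOnCylinder T V) {t : ℝ}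
    (ht : t ∈ Icc 0 T) (v : Vec d) :
    timeDeriv T V t (proj v) =
      fderivWithin ℝ (fun p : ℝ × Vec d => V p.1 (proj p.2)) (Icc 0 T ×ˢ univ) (t, v) (1, 0) :=
  (hV.hasDerivWithinAt_aux ht v).derivWithin (uniqueDiffOn_Icc hT t ht)

lemma SmoothOnCylinder.hasDerivWithinAt (hT : 0 < T) (hV : SmoothOnCylinder T V) {t : ℝ}
    (ht : t ∈ Icc 0 T) (x : Torus d) :
    HasDerivWithinAt (fun s => V s x) (timeDeriv T V t x) (Icc 0 T) t := by
  obtain ⟨v, rfl⟩ := surjective_proj x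
  rw [hV.timeDeriv_eq hT ht]
  exact hV.hasDerivWithinAt_aux ht v

lemma SmoothOnCylinder.contDiff_timeDeriv (hT : 0 < T) (hV : SmoothOnCylinder T V) {t : ℝ}
    (ht : t ∈ Icc 0 T) : ContDiff ℝ ∞ fun v : Vec d => timeDeriv T V t (proj v) := by
  simp only [hV.timeDeriv_eq hT ht]
  have h : ContDiffOn ℝ ∞ (fun p : ℝ × Vec d =>
      fderivWithin ℝ (fun p : ℝ × Vec d => V p.1 (proj p.2)) (Icc 0 T ×ˢ univ) p (1, 0))
      (Icc 0 T ×ˢ univ) :=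
    (ContDiffOn.fderivWithin hV (uniqueDiffOn_cylinder hT) (by simp)).clm_apply contDiffOn_const
  rw [← contDiffOn_univ]
  exact h.comp (f := fun v : Vec d => (t, v)) (contDiff_const.prodMk contDiff_id).contDiffOn
    fun v _ => ⟨ht, mem_univ _⟩

end

/-- Uniform bounds with constant `C` for a function on `[0,T] × M` and its derivatives. -/
structure CylinderBound (T : ℝ) (V : ℝ → Torus d → F) (C : ℝ) : Prop where
  nonneg : 0 ≤ C
  norm_le : ∀ t ∈ Icc 0 T, ∀ x, ‖V t x‖ ≤ C
  lipschitz : ∀ s ∈ Icc 0 T, ∀ t ∈ Icc 0 T, ∀ v w : Vec d,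
    ‖V s (proj v) - V t (proj w)‖ ≤ C * (|s - t| + ‖v - w‖)
  fderiv_le : ∀ t ∈ Icc 0 T, ∀ v : Vec d, ‖fderiv ℝ (fun v : Vec d => V t (proj v)) v‖ ≤ C
  fderiv_lipschitz : ∀ t ∈ Icc 0 T, ∀ v w : Vec d,
    ‖fderiv ℝ (fun v : Vec d => V t (proj v)) v - fderiv ℝ (fun v : Vec d => V t (proj v)) w‖ ≤
      C * ‖v - w‖
  taylor : ∀ s ∈ Icc 0 T, ∀ t ∈ Icc 0 T, ∀ x,
    ‖V s x - V t x - (s - t) • timeDeriv T V t x‖ ≤ C * (s - t) ^ 2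

/-- A function on an interval whose derivative is Lipschitz agrees with its first order Taylor
polynomial up to a quadratic error. -/
lemma norm_taylor_le {T C : ℝ} {r r' : ℝ → F} {s t : ℝ} (hs : s ∈ Icc 0 T) (ht : t ∈ Icc 0 T)
    (hr : ∀ q ∈ Icc 0 T, HasDerivWithinAt r (r' q) (Icc 0 T) q)
    (hl : ∀ q ∈ Icc 0 T, ‖r' q - r' t‖ ≤ C * |q - t|) (hC : 0 ≤ C) :
    ‖r s - r t - (s - t) • r' t‖ ≤ C * (s - t) ^ 2 := by
  have hsub : uIcc t s ⊆ Icc 0 T := ordConnected_Icc.uIcc_subset ht hs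
  -- Mean value inequality for `r(q) - q r'(t)` between `t` and `s`, where its derivative is at most
  -- `C |s - t|`.
  have h := (convex_uIcc t s).norm_image_sub_le_of_norm_hasDerivWithin_le
    (f := fun q => r q - q • r' t) (f' := fun q => r' q - r' t) (C := C * |s - t|)
    (fun q hq => by
      have h2 := ((hasDerivWithinAt_id q (uIcc t s)).smul_const (r' t))
      rw [one_smul] at h2
      exact ((hr q (hsub hq)).mono hsub).sub h2)
    (fun q hq => (hl q (hsub hq)).trans
      (mul_le_mul_of_nonneg_left (abs_sub_left_of_mem_uIcc hq) hC))
    left_mem_uIcc right_mem_uIcc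
  rw [Real.norm_eq_abs, mul_assoc, abs_mul_abs_self] at h
  convert h using 1
  · congr 1
    module
  · ring

/-- The lift and its space-time derivative are both periodic, hence bounded and Lipschitz. Space and
time derivatives are restrictions of the latter to vectors `(0, w)` and `(1, 0)`, so four constants
suffice and their sum serves for all fields. -/
lemma SmoothOnCylinder.exists_cylinderBound {T : ℝ} (hT : 0 < T) {V : ℝ → Torus d → F}
    (hV : SmoothOnCylinder T V) : ∃ C, CylinderBound T V C := by
  set g : ℝ × Vec d → F := fun p => V p.1 (proj p.2) with hg
  have hp : PeriodicSnd g := periodicSnd_comp_proj V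
  have hp' := hp.fderivWithin (T := T)
  have hd : ContDiffOn ℝ ∞ (fderivWithin ℝ g (Icc 0 T ×ˢ univ)) (Icc 0 T ×ˢ univ) :=
    ContDiffOn.fderivWithin hV (uniqueDiffOn_cylinder hT) (by simp)
  obtain ⟨C₁, h₁, H₁⟩ := hp.exists_bound (ContDiffOn.continuousOn hV)
  obtain ⟨C₂, h₂, H₂⟩ := hp.exists_lipschitz hT hV
  obtain ⟨C₃, h₃, H₃⟩ := hp'.exists_bound hd.continuousOn
  obtain ⟨C₄, h₄, H₄⟩ := hp'.exists_lipschitz hT hd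
  have hinr : ‖ContinuousLinearMap.inr ℝ ℝ (Vec d)‖ ≤ 1 :=
    ContinuousLinearMap.opNorm_le_bound _ zero_le_one fun v => by simp
  refine ⟨C₁ + C₂ + C₃ + C₄, by positivity, ?_, ?_, ?_, ?_, ?_⟩
  · intro t ht x
    obtain ⟨v, rfl⟩ := surjective_proj x
    exact (H₁ (t, v) ⟨ht, mem_univ _⟩).trans (by linarith)
  · intro s hs t ht v w
    refine (H₂ (s, v) ⟨hs, mem_univ _⟩ (t, w) ⟨ht, mem_univ _⟩).trans ?_
    refine mul_le_mul (by linarith) ?_ (norm_nonneg _) (by positivity)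
    rw [Prod.mk_sub_mk, Prod.norm_mk, Real.norm_eq_abs]
    exact max_le_add_of_nonneg (abs_nonneg _) (norm_nonneg _)
  · intro t ht v
    rw [hV.fderiv_slice ht]
    refine (ContinuousLinearMap.opNorm_comp_le _ _).trans ?_
    calc _ ≤ C₃ * 1 := mul_le_mul (H₃ (t, v) ⟨ht, mem_univ _⟩) hinr (norm_nonneg _) h₃
      _ ≤ _ := by linarith
  · intro t ht v w
    rw [hV.fderiv_slice ht, hV.fderiv_slice ht, ← ContinuousLinearMap.sub_comp]
    refine (ContinuousLinearMap.opNorm_comp_le _ _).trans ?_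
    have h := H₄ (t, v) ⟨ht, mem_univ _⟩ (t, w) ⟨ht, mem_univ _⟩
    have he : ‖((t, v) : ℝ × Vec d) - (t, w)‖ = ‖v - w‖ := by simp [Prod.norm_mk]
    rw [he] at h
    calc _ ≤ (C₄ * ‖v - w‖) * 1 := mul_le_mul h hinr (norm_nonneg _) (by positivity)
      _ ≤ _ := by nlinarith [norm_nonneg (v - w)]
  · intro s hs t ht x
    obtain ⟨v, rfl⟩ := surjective_proj x
    rw [hV.timeDeriv_eq hT ht]
    refine (norm_taylor_le (C := C₄) hs ht (fun q hq => hV.hasDerivWithinAt_aux hq v)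
      (fun q hq => ?_) h₄).trans (mul_le_mul_of_nonneg_right (by linarith) (sq_nonneg _))
    rw [← sub_apply]
    refine (ContinuousLinearMap.le_opNorm _ _).trans ?_
    have h := H₄ (q, v) ⟨hq, mem_univ _⟩ (t, v) ⟨ht, mem_univ _⟩
    have he : ‖((q, v) : ℝ × Vec d) - (t, v)‖ = |q - t| := by simp [Prod.norm_mk]
    have h1 : ‖((1, 0) : ℝ × Vec d)‖ = 1 := by simp [Prod.norm_mk]
    rw [he] at h
    rwa [h1, mul_one]

end TransportNewton

/-! ### Trajectories and explicit Euler steps. -/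

namespace TransportNewton

variable {d : ℕ} {T C : ℝ} {V : ℝ → Torus d → Vec d}

/-! ### The flow of a smooth field -/

/-- `γ` is a lift to `ℝ^d` of a solution of `dc/dt = V(t, c(t))`. -/
def LiftSolves (T : ℝ) (V : ℝ → Torus d → Vec d) (γ : ℝ → Vec d) : Prop :=
  ∀ t ∈ Icc (0 : ℝ) T, HasDerivWithinAt γ (V t (proj (γ t))) (Icc 0 T) t

lemma solvesODE_iff {c : ℝ → Torus d} :
    SolvesODE T V c ↔ ∃ γ, LiftSolves T V γ ∧ ∀ t ∈ Icc (0 : ℝ) T, c t = proj (γ t) := by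
  constructor
  · rintro ⟨γ, hγ⟩
    refine ⟨γ, fun t ht => ?_, fun t ht => (hγ t ht).1⟩
    rw [← (hγ t ht).1]
    exact (hγ t ht).2
  · rintro ⟨γ, h1, h2⟩
    refine ⟨γ, fun t ht => ⟨h2 t ht, ?_⟩⟩
    rw [h2 t ht]
    exact h1 t ht

/-- The speed is at most `C` everywhere, so a ball of radius `C T` cannot be left before time `T`,
and Picard–Lindelöf applies on all of `[0,T]` at once. -/
lemma CylinderBound.exists_liftSolves (hT : 0 < T) (hV : CylinderBound T V C) (v : Vec d) :
    ∃ γ, LiftSolves T V γ ∧ γ 0 = v := by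
  have hpl : IsPicardLindelof (fun t w => V t (proj w)) (tmin := 0) (tmax := T)
      ⟨0, left_mem_Icc.2 hT.le⟩ v (C.toNNReal * T.toNNReal) 0 C.toNNReal C.toNNReal := by
    refine ⟨fun t ht => ?_, fun w _ => ?_, fun t ht w _ => ?_, ?_⟩
    · refine LipschitzOnWith.of_dist_le_mul fun w _ z _ => ?_
      rw [dist_eq_norm, dist_eq_norm, Real.coe_toNNReal _ hV.nonneg]
      simpa using hV.lipschitz t ht t ht w z
    · refine LipschitzOnWith.continuousOn (K := C.toNNReal)
        (LipschitzOnWith.of_dist_le_mul fun s hs t ht => ?_)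
      rw [dist_eq_norm, dist_eq_norm, Real.coe_toNNReal _ hV.nonneg]
      simpa using hV.lipschitz s hs t ht w w
    · rw [Real.coe_toNNReal _ hV.nonneg]
      exact hV.norm_le t ht _
    · simp [hT.le]
  obtain ⟨γ, h0, hγ⟩ := hpl.exists_eq_forall_mem_Icc_hasDerivWithinAt₀
  exact ⟨γ, hγ, h0⟩

lemma LiftSolves.continuousOn {γ : ℝ → Vec d} (h : LiftSolves T V γ) :
    ContinuousOn γ (Icc 0 T) := fun t ht => (h t ht).continuousWithinAt

/-- Grönwall; it gives both uniqueness and continuous dependence on the initial point. -/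
lemma CylinderBound.dist_le (hV : CylinderBound T V C) {γ η : ℝ → Vec d}
    (hγ : LiftSolves T V γ) (hη : LiftSolves T V η) :
    ∀ t ∈ Icc (0 : ℝ) T, dist (γ t) (η t) ≤ dist (γ 0) (η 0) * Real.exp (C * t) := by
  have hder : ∀ {α : ℝ → Vec d}, LiftSolves T V α → ∀ t ∈ Ico (0 : ℝ) T,
      HasDerivWithinAt α (V t (proj (α t))) (Ici t) t := fun hα t ht =>
    (hα t (Ico_subset_Icc_self ht)).mono_of_mem_nhdsWithin
      (Filter.mem_of_superset (Icc_mem_nhdsGE ht.2) (Icc_subset_Icc_left ht.1))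
  have h := dist_le_of_trajectories_ODE_of_mem (K := C.toNNReal) (a := 0) (b := T)
    (v := fun t w => V t (proj w)) (s := fun _ => univ) (f := γ) (g := η)
    (fun t ht => LipschitzOnWith.of_dist_le_mul fun w _ z _ => by
      rw [dist_eq_norm, dist_eq_norm, Real.coe_toNNReal _ hV.nonneg]
      simpa using hV.lipschitz t (Ico_subset_Icc_self ht) t (Ico_subset_Icc_self ht) w z)
    hγ.continuousOn (hder hγ) (fun _ _ => mem_univ _) hη.continuousOn (hder hη)
    (fun _ _ => mem_univ _) le_rfl
  simpa only [sub_zero, Real.coe_toNNReal _ hV.nonneg] using h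

lemma LiftSolves.add_period {γ : ℝ → Vec d} (h : LiftSolves T V γ) {δ : Vec d}
    (hδ : proj δ = 0) : LiftSolves T V fun t => γ t + δ := by
  intro t ht
  simp only [proj_add, hδ, add_zero]
  exact (h t ht).add_const δ

/-- The flow of a field on the torus: it is measurable in the initial point, and every solution
is one of its trajectories. -/
lemma CylinderBound.exists_flow (hT : 0 < T) (hV : CylinderBound T V C) :
    ∃ Fl : ℝ → Torus d → Torus d, (∀ x, Fl 0 x = x) ∧ (∀ t ∈ Icc (0 : ℝ) T, Measurable (Fl t)) ∧
      (∀ x, SolvesODE T V fun t => Fl t x) ∧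
      ∀ c, SolvesODE T V c → ∀ t ∈ Icc (0 : ℝ) T, c t = Fl t (c 0) := by
  choose Γ hΓ hΓ0 using hV.exists_liftSolves hT
  refine ⟨fun t x => proj (Γ (liftCube x) t), fun x => ?_, fun t ht => ?_, fun x => ?_,
    fun c hc t ht => ?_⟩
  · simp only [hΓ0, proj_liftCube]
  -- `liftCube` is discontinuous at faces of the cube, so measurability comes from a continuous map
  -- composed with a measurable one.
  · have hlip : LipschitzWith (Real.exp (C * t)).toNNReal fun v => Γ v t := by
      refine LipschitzWith.of_dist_le_mul fun v w => ?_
      rw [Real.coe_toNNReal _ (Real.exp_pos _).le, mul_comm]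
      simpa only [hΓ0] using hV.dist_le (hΓ v) (hΓ w) t ht
    exact (continuous_proj.comp hlip.continuous).measurable.comp measurable_liftCube
  · exact solvesODE_iff.2 ⟨_, hΓ _, fun t _ => rfl⟩
  · obtain ⟨γ, hγ, hcγ⟩ := solvesODE_iff.1 hc
    -- Two lifts of the same initial point differ by a period; translating `γ` by it allows
    -- uniqueness in `ℝ^d` to be used.
    have hδ : proj (liftCube (c 0) - γ 0) = 0 := by
      rw [proj_sub, proj_liftCube, hcγ 0 (left_mem_Icc.2 hT.le), sub_self]
    have h := hV.dist_le (hγ.add_period hδ) (hΓ (liftCube (c 0))) t ht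
    rw [hΓ0, add_sub_cancel, dist_self, zero_mul] at h
    beta_reduce
    rw [hcγ t ht, ← dist_le_zero.1 h, proj_add, hδ, add_zero]

/-- One explicit Euler step along a trajectory has a quadratic error. -/
lemma CylinderBound.norm_euler_le (hV : CylinderBound T V C) {γ : ℝ → Vec d}
    (hγ : LiftSolves T V γ) {s t : ℝ} (hs : s ∈ Icc 0 T) (ht : t ∈ Icc 0 T) :
    ‖γ s - γ t - (s - t) • V t (proj (γ t))‖ ≤ C * (1 + C) * (s - t) ^ 2 := by
  have hC := hV.nonneg
  refine norm_taylor_le hs ht hγ (fun q hq => ?_) (by positivity)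
  -- A trajectory moves with speed at most `C`, so its velocity is Lipschitz in time with constant
  -- `C (1 + C)`.
  have h1 : ‖γ q - γ t‖ ≤ C * |q - t| :=
    (convex_Icc 0 T).norm_image_sub_le_of_norm_hasDerivWithin_le hγ
      (fun r hr => hV.norm_le r hr _) ht hq
  refine (hV.lipschitz q hq t ht _ _).trans ?_
  calc C * (|q - t| + ‖γ q - γ t‖) ≤ C * (|q - t| + C * |q - t|) := by gcongr
    _ = C * (1 + C) * |q - t| := by ring

/-! ### Test functions with bounded gradient and Lipschitz gradient -/

/-- `u` is smooth with gradient bounded by `A` and `B`-Lipschitz. -/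
structure TestBound (u : Torus d → ℝ) (A B : ℝ) : Prop where
  smooth : Smooth u
  fderiv_le : ∀ v : Vec d, ‖fderiv ℝ (fun v : Vec d => u (proj v)) v‖ ≤ A
  fderiv_lipschitz : ∀ v w : Vec d, ‖fderiv ℝ (fun v : Vec d => u (proj v)) v -
    fderiv ℝ (fun v : Vec d => u (proj v)) w‖ ≤ B * ‖v - w‖

lemma Smooth.exists_testBound {u : Torus d → ℝ} (hu : Smooth u) :
    ∃ A B, 0 ≤ A ∧ 0 ≤ B ∧ TestBound u A B := by
  have h : SmoothOnCylinder 1 fun _ : ℝ => u :=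
    (ContDiff.comp (g := fun v : Vec d => u (proj v)) hu contDiff_snd).contDiffOn
  obtain ⟨C, hC⟩ := h.exists_cylinderBound one_pos
  have h0 : (0 : ℝ) ∈ Icc (0 : ℝ) 1 := by simp
  exact ⟨C, C, hC.nonneg, hC.nonneg, hu, hC.fderiv_le 0 h0, hC.fderiv_lipschitz 0 h0⟩

namespace TestBound

variable {u : Torus d → ℝ} {A B : ℝ}

lemma differentiable (hu : TestBound u A B) :
    Differentiable ℝ fun v : Vec d => u (proj v) :=
  ContDiff.differentiable hu.smooth (by simp)

lemma abs_sub_le (hu : TestBound u A B) (v w : Vec d) :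
    |u (proj v) - u (proj w)| ≤ A * ‖v - w‖ :=
  convex_univ.norm_image_sub_le_of_norm_fderiv_le (𝕜 := ℝ) (fun z _ => hu.differentiable z)
    (fun z _ => hu.fderiv_le z) (mem_univ w) (mem_univ v)

lemma taylor (hu : TestBound u A B) (hB : 0 ≤ B) (v w : Vec d) :
    |u (proj (v + w)) - u (proj v) - fderiv ℝ (fun v : Vec d => u (proj v)) v w| ≤
      B * ‖w‖ ^ 2 := by
  have h := (convex_closedBall v ‖w‖).norm_image_sub_le_of_norm_fderiv_le' (𝕜 := ℝ)
    (f := fun v : Vec d => u (proj v)) (φ := fderiv ℝ (fun v : Vec d => u (proj v)) v)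
    (C := B * ‖w‖) (x := v) (y := v + w) (fun z _ => hu.differentiable z)
    (fun z hz => (hu.fderiv_lipschitz z v).trans
      (mul_le_mul_of_nonneg_left (by simpa [dist_eq_norm] using hz) hB))
    (Metric.mem_closedBall_self (norm_nonneg _)) (by simp [dist_eq_norm])
  rw [add_sub_cancel_left, Real.norm_eq_abs, mul_assoc, ← sq] at h
  exact h

end TestBound

/-- `u` composed with the Euler step `x ↦ x + h W(x)`. -/
noncomputable def eulerPull (h : ℝ) (W : Torus d → Vec d) (u : Torus d → ℝ) (x : Torus d) : ℝ :=
  u (x + proj (h • W x))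

lemma eulerPull_proj (h : ℝ) (W : Torus d → Vec d) (u : Torus d → ℝ) (v : Vec d) :
    eulerPull h W u (proj v) = u (proj (v + h • W (proj v))) := by
  rw [eulerPull, proj_add]

/-- With `g = id + h W`, the derivative of the pullback is `Du(g) ∘ Dg`, where `‖Dg‖ ≤ 1 + hC` and
`Dg` is `hC`-Lipschitz. The bounds grow only by factors `1 + O(h)`, which is what makes iteration
over `O(1/h)` steps possible. -/
lemma TestBound.testBound_eulerPull {u : Torus d → ℝ} {A B h : ℝ} {W : Torus d → Vec d}
    (hu : TestBound u A B) (hA : 0 ≤ A) (hB : 0 ≤ B) (hh : 0 ≤ h) (hC : 0 ≤ C)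
    (hW : ContDiff ℝ ∞ fun v : Vec d => W (proj v))
    (hW1 : ∀ v, ‖fderiv ℝ (fun v : Vec d => W (proj v)) v‖ ≤ C)
    (hW2 : ∀ v w, ‖fderiv ℝ (fun v : Vec d => W (proj v)) v -
      fderiv ℝ (fun v : Vec d => W (proj v)) w‖ ≤ C * ‖v - w‖) :
    TestBound (eulerPull h W u) (A * (1 + h * C)) (B * (1 + h * C) ^ 2 + A * (h * C)) := by
  set g : Vec d → Vec d := fun v => v + h • W (proj v) with hg
  set D : Vec d → Vec d →L[ℝ] Vec d := fun v =>
    ContinuousLinearMap.id ℝ (Vec d) + h • fderiv ℝ (fun v : Vec d => W (proj v)) v with hD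
  have hgs : ContDiff ℝ ∞ g := contDiff_id.add (hW.const_smul h)
  have hgd : ∀ v, HasFDerivAt g (D v) v := fun v =>
    (hasFDerivAt_id v).add ((hW.differentiable (by simp) v).hasFDerivAt.const_smul h)
  have hDn : ∀ v, ‖D v‖ ≤ 1 + h * C := fun v => by
    refine (norm_add_le _ _).trans (add_le_add ContinuousLinearMap.norm_id_le ?_)
    rw [norm_smul, Real.norm_of_nonneg hh]
    exact mul_le_mul_of_nonneg_left (hW1 v) hh
  have hDl : ∀ v w, ‖D v - D w‖ ≤ h * C * ‖v - w‖ := fun v w => by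
    have he : D v - D w = h • (fderiv ℝ (fun v : Vec d => W (proj v)) v -
        fderiv ℝ (fun v : Vec d => W (proj v)) w) := by
      simp only [hD, add_sub_add_left_eq_sub]
      exact (smul_sub h _ _).symm
    rw [he, norm_smul, Real.norm_of_nonneg hh, mul_assoc]
    exact mul_le_mul_of_nonneg_left (hW2 v w) hh
  have hgl : ∀ v w, ‖g v - g w‖ ≤ (1 + h * C) * ‖v - w‖ := fun v w =>
    convex_univ.norm_image_sub_le_of_norm_hasFDerivWithin_le (𝕜 := ℝ)
      (fun z _ => (hgd z).hasFDerivWithinAt) (fun z _ => hDn z) (mem_univ w) (mem_univ v)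
  have hq : 0 ≤ 1 + h * C := by positivity
  have hf : ∀ v, fderiv ℝ (fun v : Vec d => eulerPull h W u (proj v)) v =
      (fderiv ℝ (fun v : Vec d => u (proj v)) (g v)).comp (D v) := fun v => by
    simp only [eulerPull_proj]
    exact ((hu.differentiable (g v)).hasFDerivAt.comp v (hgd v)).fderiv
  refine ⟨?_, fun v => ?_, fun v w => ?_⟩
  · unfold Smooth
    simp only [eulerPull_proj]
    exact ContDiff.comp (g := fun v : Vec d => u (proj v)) hu.smooth hgs
  · rw [hf]
    exact (ContinuousLinearMap.opNorm_comp_le _ _).trans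
      (mul_le_mul (hu.fderiv_le _) (hDn v) (norm_nonneg _) hA)
  · rw [hf, hf]
    set P := fderiv ℝ (fun v : Vec d => u (proj v)) with hP
    have he : (P (g v)).comp (D v) - (P (g w)).comp (D w) =
        (P (g v) - P (g w)).comp (D v) + (P (g w)).comp (D v - D w) := by
      rw [ContinuousLinearMap.sub_comp, ContinuousLinearMap.comp_sub]
      abel
    have h1 : ‖P (g v) - P (g w)‖ ≤ B * ((1 + h * C) * ‖v - w‖) :=
      (hu.fderiv_lipschitz _ _).trans (mul_le_mul_of_nonneg_left (hgl v w) hB)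
    rw [he]
    calc _ ≤ ‖(P (g v) - P (g w)).comp (D v)‖ + ‖(P (g w)).comp (D v - D w)‖ := norm_add_le _ _
      _ ≤ B * ((1 + h * C) * ‖v - w‖) * (1 + h * C) + A * (h * C * ‖v - w‖) :=
          add_le_add
            ((ContinuousLinearMap.opNorm_comp_le _ _).trans
              (mul_le_mul h1 (hDn v) (norm_nonneg _) (by positivity)))
            ((ContinuousLinearMap.opNorm_comp_le _ _).trans
              (mul_le_mul (hu.fderiv_le _) (hDl v w) (norm_nonneg _) hA))
      _ = _ := by ring

end TransportNewton

/-! ### Equivalence of the continuity equation and the particle system. -/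

namespace TransportNewton

variable {d : ℕ} {T C R : ℝ} {V : ℝ → Torus d → Vec d} {ρ : ℝ → Torus d → ℝ}

/-! ### Expectations along trajectories and along density curves -/

/-- The directional derivative `∇ u · W`. -/
noncomputable def dirDeriv (u : Torus d → ℝ) (W : Torus d → Vec d) (x : Torus d) : ℝ :=
  ∑ i, pd i u x * W x i

/-- `W` is a smooth vector field. -/
def SmoothField (W : Torus d → Vec d) : Prop := ContDiff ℝ ∞ fun v : Vec d => W (proj v)

lemma SmoothField.apply {W : Torus d → Vec d} (hW : SmoothField W) (i : Fin d) :
    Smooth fun x => W x i :=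
  (EuclideanSpace.proj i : Vec d →L[ℝ] ℝ).contDiff.comp hW

lemma SmoothField.smooth_dirDeriv {W : Torus d → Vec d} (hW : SmoothField W) {u : Torus d → ℝ}
    (hu : Smooth u) : Smooth (dirDeriv u W) :=
  Smooth.sum fun i _ => (hu.smooth_pd i).mul (hW.apply i)

lemma SmoothField.smooth_div {W : Torus d → Vec d} (hW : SmoothField W) {r : Torus d → ℝ}
    (hr : Smooth r) : Smooth fun x => ∑ i, pd i (fun z => r z * W z i) x :=
  Smooth.sum fun i _ => (hr.mul (hW.apply i)).smooth_pd i

lemma SmoothField.integral_dirDeriv {W : Torus d → Vec d} (hW : SmoothField W)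
    {u r : Torus d → ℝ} (hu : Smooth u) (hr : Smooth r) :
    ∫ x, dirDeriv u W x * r x = -∫ x, u x * ∑ i, pd i (fun z => r z * W z i) x := by
  simp only [dirDeriv, Finset.sum_mul, Finset.mul_sum]
  rw [integral_finsetSum _ fun i _ => (((hu.smooth_pd i).mul (hW.apply i)).mul hr).integrable,
    integral_finsetSum _ fun i _ => (hu.mul ((hr.mul (hW.apply i)).smooth_pd i)).integrable,
    ← Finset.sum_neg_distrib]
  refine Finset.sum_congr rfl fun i _ => ?_
  rw [integral_mul_pd hu (hr.mul (hW.apply i)), neg_neg]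
  refine integral_congr_ae (Filter.Eventually.of_forall fun x => ?_)
  dsimp only
  ring

lemma TestBound.abs_eulerPull_sub_le {u : Torus d → ℝ} {A B : ℝ} (hu : TestBound u A B)
    (hB : 0 ≤ B) {W : Torus d → Vec d} (hW : ∀ x, ‖W x‖ ≤ C) (h : ℝ) (x : Torus d) :
    |eulerPull h W u x - u x - h * dirDeriv u W x| ≤ B * C ^ 2 * h ^ 2 := by
  obtain ⟨v, rfl⟩ := surjective_proj x
  have h1 := hu.taylor hB v (h • W (proj v))
  rw [map_smul, hu.smooth.fderiv_proj, norm_smul, Real.norm_eq_abs, mul_pow, sq_abs] at h1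
  rw [eulerPull_proj]
  refine h1.trans ?_
  have h2 : ‖W (proj v)‖ ^ 2 ≤ C ^ 2 := pow_le_pow_left₀ (norm_nonneg _) (hW _) 2
  calc B * (h ^ 2 * ‖W (proj v)‖ ^ 2) ≤ B * (h ^ 2 * C ^ 2) := by gcongr
    _ = _ := by ring

/-- An explicit Euler step follows a trajectory up to a quadratic error. -/
lemma TestBound.abs_sub_eulerPull_le {u : Torus d → ℝ} {A B : ℝ} (hu : TestBound u A B)
    (hA : 0 ≤ A) (hV : CylinderBound T V C) {c : ℝ → Torus d} (hc : SolvesODE T V c) {s t : ℝ}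
    (hs : s ∈ Icc 0 T) (ht : t ∈ Icc 0 T) :
    |u (c s) - eulerPull (s - t) (V t) u (c t)| ≤ A * (C * (1 + C)) * (s - t) ^ 2 := by
  obtain ⟨γ, hγ, hcγ⟩ := solvesODE_iff.1 hc
  rw [hcγ s hs, hcγ t ht, eulerPull_proj]
  refine (hu.abs_sub_le _ _).trans ?_
  rw [← sub_sub, mul_assoc]
  exact mul_le_mul_of_nonneg_left (hV.norm_euler_le hγ hs ht) hA

lemma abs_integral_sub_le {X : Type*} [MeasurableSpace X] {μ : Measure X} [IsProbabilityMeasure μ]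
    {f g : X → ℝ} {K : ℝ} (hf : Integrable f μ) (hg : Integrable g μ)
    (h : ∀ᵐ x ∂μ, |f x - g x| ≤ K) : |(∫ x, f x ∂μ) - ∫ x, g x ∂μ| ≤ K := by
  rw [← integral_sub hf hg]
  simpa using norm_integral_le_of_norm_le_const (f := fun x => f x - g x) h

lemma Smooth.integrable_comp {Ω : Type*} [MeasurableSpace Ω] {P : Measure Ω}
    [IsProbabilityMeasure P] {u : Torus d → ℝ} (hu : Smooth u) {Y : Ω → Torus d}
    (hY : AEMeasurable Y P) : Integrable (fun w => u (Y w)) P := by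
  obtain ⟨M, -, hM⟩ := hu.exists_bound
  exact Integrable.of_bound (hu.continuous.measurable.comp_aemeasurable hY).aestronglyMeasurable M
    (Filter.Eventually.of_forall fun w => hM _)

lemma isProbabilityMeasure_densityMeasure {r : Torus d → ℝ} (hr : r ∈ Densities d) :
    IsProbabilityMeasure (densityMeasure r) := by
  refine ⟨?_⟩
  rw [densityMeasure, withDensity_apply _ MeasurableSet.univ, Measure.restrict_univ,
    ← ofReal_integral_eq_lintegral_ofReal hr.1.integrable
      (Filter.Eventually.of_forall fun x => (hr.2.1 x).le), hr.2.2, ENNReal.ofReal_one]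

lemma integral_densityMeasure_mul {r : Torus d → ℝ} (hr : r ∈ Densities d) (u : Torus d → ℝ) :
    ∫ x, u x ∂(densityMeasure r) = ∫ x, u x * r x := by
  rw [integral_densityMeasure hr.1 hr.2.1]
  simp only [smul_eq_mul, mul_comm]

lemma integral_comp_of_hasLaw {Ω : Type*} [MeasurableSpace Ω] {P : Measure Ω}
    {u r : Torus d → ℝ} (hu : Smooth u) (hr : r ∈ Densities d) {Y : Ω → Torus d}
    (hY : ProbabilityTheory.HasLaw Y (densityMeasure r) P) :
    ∫ w, u (Y w) ∂P = ∫ x, u x * r x := by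
  rw [← integral_densityMeasure_mul hr, ← hY.map_eq,
    integral_map hY.aemeasurable hu.continuous.aestronglyMeasurable]

/-- First order expansion in time of `∫ u ρ_t`. -/
lemma CylinderBound.abs_integral_sub_le (hT : 0 < T) (hρ : SmoothOnCylinder T ρ)
    (hR : CylinderBound T ρ R) {u : Torus d → ℝ} (hu : Smooth u) {M : ℝ} (hM : ∀ x, |u x| ≤ M)
    {s t : ℝ} (hs : s ∈ Icc 0 T) (ht : t ∈ Icc 0 T) :
    |(∫ x, u x * ρ s x) - ((∫ x, u x * ρ t x) + (s - t) * ∫ x, u x * timeDeriv T ρ t x)| ≤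
      M * R * (s - t) ^ 2 := by
  have h1 : Smooth fun x => u x * ρ s x := hu.mul (hρ.slice hs)
  have h2 : Smooth fun x => u x * ρ t x := hu.mul (hρ.slice ht)
  have h3 : Smooth fun x => u x * timeDeriv T ρ t x := hu.mul (hρ.contDiff_timeDeriv hT ht)
  have h4 : Smooth fun x => (s - t) * (u x * timeDeriv T ρ t x) := (smooth_const _).mul h3
  rw [← integral_const_mul, ← integral_add h2.integrable h4.integrable]
  refine TransportNewton.abs_integral_sub_le h1.integrable (h2.add h4).integrable
    (Filter.Eventually.of_forall fun x => ?_)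
  have h5 := hR.taylor s hs t ht x
  have h6 : u x * ρ s x - (u x * ρ t x + (s - t) * (u x * timeDeriv T ρ t x)) =
      u x * (ρ s x - ρ t x - (s - t) • timeDeriv T ρ t x) := by
    rw [smul_eq_mul]; ring
  rw [h6, abs_mul, mul_assoc]
  exact mul_le_mul (hM x) h5 (abs_nonneg _) ((abs_nonneg _).trans (hM x))

/-- First order expansion in time of `𝔼 u(X_t)`. -/
lemma TestBound.abs_integral_sub_le {u : Torus d → ℝ} {A B : ℝ} (hu : TestBound u A B)
    (hB : 0 ≤ B) {W : Torus d → Vec d} (hWs : SmoothField W) (hW : ∀ x, ‖W x‖ ≤ C)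
    {μ : Measure (Torus d)} [IsProbabilityMeasure μ] {h : ℝ} (he : Smooth (eulerPull h W u)) :
    |(∫ x, eulerPull h W u x ∂μ) - ((∫ x, u x ∂μ) + h * ∫ x, dirDeriv u W x ∂μ)| ≤
      B * C ^ 2 * h ^ 2 := by
  have h2 : Integrable u μ := hu.smooth.integrable_comp aemeasurable_id
  have h3 : Integrable (dirDeriv u W) μ :=
    (hWs.smooth_dirDeriv hu.smooth).integrable_comp aemeasurable_id
  have h4 : Integrable (eulerPull h W u) μ := he.integrable_comp aemeasurable_id
  rw [← integral_const_mul, ← integral_add h2 (h3.const_mul h)]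
  refine TransportNewton.abs_integral_sub_le h4 (h2.add (h3.const_mul h))
    (Filter.Eventually.of_forall fun x => ?_)
  rw [← sub_sub]
  exact hu.abs_eulerPull_sub_le hB hW h x

lemma smooth_eulerPull {u : Torus d → ℝ} (hu : Smooth u) {W : Torus d → Vec d}
    (hW : SmoothField W) (h : ℝ) : Smooth (eulerPull h W u) := by
  unfold Smooth
  simp only [eulerPull_proj]
  exact ContDiff.comp (g := fun v : Vec d => u (proj v)) hu
    (contDiff_id.add (ContDiff.const_smul h hW))

section Particles

variable {Ω : Type*} [MeasurableSpace Ω] {P : Measure Ω} [IsProbabilityMeasure P]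
  {X : ℝ → Ω → Torus d}

lemma TestBound.abs_expect_sub_le {u : Torus d → ℝ} {A B : ℝ} (hu : TestBound u A B)
    (hA : 0 ≤ A) (hVs : SmoothOnCylinder T V) (hV : CylinderBound T V C)
    (hX : ∀ t ∈ Icc (0 : ℝ) T, AEMeasurable (X t) P) (hdr : IsDrivenBy P T V X) {s t : ℝ}
    (hs : s ∈ Icc 0 T) (ht : t ∈ Icc 0 T) :
    |(∫ w, u (X s w) ∂P) - ∫ w, eulerPull (s - t) (V t) u (X t w) ∂P| ≤
      A * (C * (1 + C)) * (s - t) ^ 2 :=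
  TransportNewton.abs_integral_sub_le (hu.smooth.integrable_comp (hX s hs))
    ((smooth_eulerPull hu.smooth (hVs.slice ht) _).integrable_comp (hX t ht))
    (hdr.mono fun _ hw => hu.abs_sub_eulerPull_le hA hV hw hs ht)

/-! ### From particles to the continuity equation -/

lemma eq_zero_of_forall_abs_le {T t q K : ℝ} (hT : 0 < T) (ht : t ∈ Icc 0 T) (hK : 0 ≤ K)
    (h : ∀ s ∈ Icc (0 : ℝ) T, |(s - t) * q| ≤ K * (s - t) ^ 2) : q = 0 := by
  by_contra hq
  have hq' : 0 < |q| := abs_pos.2 hq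
  -- `ε ≤ T / 2` keeps `t + ε` or `t - ε` in `[0,T]`; the other bound makes `K ε < |q|`, against the
  -- hypothesis divided by `ε`.
  set ε := min (T / 2) (|q| / (2 * (K + 1))) with hε
  have hε0 : 0 < ε := lt_min (by linarith) (by positivity)
  have hεT : ε ≤ T / 2 := min_le_left _ _
  have hεq : ε * (2 * (K + 1)) ≤ |q| := (le_div_iff₀ (by positivity)).1 (min_le_right _ _)
  have key : ∀ s ∈ Icc (0 : ℝ) T, |s - t| = ε → False := by
    intro s hs hst
    have h1 := h s hs
    rw [abs_mul, hst, ← sq_abs, hst] at h1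
    have h2 : |q| ≤ K * ε := by
      refine le_of_mul_le_mul_left ?_ hε0
      linarith
    nlinarith
  rcases le_total t (T / 2) with h1 | h1
  · refine key (t + ε) ⟨by linarith [ht.1], by linarith⟩ ?_
    rw [add_sub_cancel_left, abs_of_pos hε0]
  · refine key (t - ε) ⟨by linarith, by linarith [ht.2]⟩ ?_
    rw [sub_sub_cancel_left, abs_neg, abs_of_pos hε0]

/-- `𝔼 u(X_s)` is expanded to first order at `t` twice: through the density, with slope `∫ u ∂_t ρ`,
and through an Euler step, with slope `∫ (∇u · V) ρ`. Equal slopes are the weak equation; the test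
function `∂_t ρ + ∇ · (ρ V)` makes it pointwise. -/
theorem continuityEq_of_isDrivenBy (hT : 0 < T) (hρ : IsDensityCurve T ρ)
    (hVs : SmoothOnCylinder T V) (hX : HasDensity P T ρ X) (hdr : IsDrivenBy P T V X) :
    ContinuityEq T ρ V := by
  obtain ⟨R, hR⟩ := hρ.1.exists_cylinderBound hT
  obtain ⟨C, hV⟩ := hVs.exists_cylinderBound hT
  intro t ht x
  have hVt : SmoothField (V t) := hVs.slice ht
  have hρt : Smooth (ρ t) := (hρ.2 t ht).1
  have hdt : Smooth (timeDeriv T ρ t) := hρ.1.contDiff_timeDeriv hT ht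
  have weak : ∀ u : Torus d → ℝ, Smooth u →
      ∫ x, u x * timeDeriv T ρ t x = ∫ x, dirDeriv u (V t) x * ρ t x := by
    intro u hu
    obtain ⟨A, B, hA, hB, hb⟩ := hu.exists_testBound
    obtain ⟨M, hM0, hM⟩ := hu.exists_bound
    have hprob := isProbabilityMeasure_densityMeasure (hρ.2 t ht)
    have hC := hV.nonneg
    have hR0 := hR.nonneg
    rw [← sub_eq_zero]
    refine eq_zero_of_forall_abs_le hT ht
      (K := M * R + (A * (C * (1 + C)) + B * C ^ 2)) (by positivity) fun s hs => ?_
    have h1 := hR.abs_integral_sub_le hT hρ.1 hu hM hs ht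
    have h2 := hb.abs_expect_sub_le hA hVs hV (fun r hr => (hX r hr).aemeasurable) hdr hs ht
    have he := smooth_eulerPull hu hVt (s - t)
    have h3 := hb.abs_integral_sub_le hB hVt (hV.norm_le t ht) (μ := densityMeasure (ρ t)) he
    rw [integral_densityMeasure_mul (hρ.2 t ht), integral_densityMeasure_mul (hρ.2 t ht),
      integral_densityMeasure_mul (hρ.2 t ht)] at h3
    rw [integral_comp_of_hasLaw hu (hρ.2 s hs) (hX s hs),
      integral_comp_of_hasLaw he (hρ.2 t ht) (hX t ht)] at h2
    rw [abs_le] at h1 h2 h3 ⊢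
    constructor <;> linarith [h1.1, h1.2, h2.1, h2.2, h3.1, h3.2]
  have hdiv := hVt.smooth_div hρt
  have hzero := (hdt.add hdiv).eq_zero_of_integral_sq (by
    have hg := hdt.add hdiv
    have h1 := weak _ hg
    rw [hVt.integral_dirDeriv hg hρt, eq_neg_iff_add_eq_zero,
      ← integral_add (hg.mul hdt).integrable (hg.mul hdiv).integrable] at h1
    rw [← h1]
    refine integral_congr_ae (Filter.Eventually.of_forall fun x => ?_)
    dsimp only
    ring) x
  rw [← eq_neg_of_add_eq_zero_left hzero]
  exact hρ.1.hasDerivWithinAt hT ht x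

/-! ### From the continuity equation to particles -/

/-- One backward Euler step for `𝔼 u(X_t) - ∫ u ρ_t`. -/
lemma TestBound.abs_defect_sub_le (hT : 0 < T) (hρ : IsDensityCurve T ρ)
    (hR : CylinderBound T ρ R) (hVs : SmoothOnCylinder T V) (hV : CylinderBound T V C)
    (hc : ContinuityEq T ρ V)
    (hX : ∀ t ∈ Icc (0 : ℝ) T, AEMeasurable (X t) P) (hdr : IsDrivenBy P T V X)
    {u : Torus d → ℝ} {Z M : ℝ} (hZ : 0 ≤ Z) (hu : TestBound u Z Z) (hM : ∀ x, |u x| ≤ M)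
    {s t : ℝ} (hs : s ∈ Icc 0 T) (ht : t ∈ Icc 0 T) :
    |((∫ w, u (X s w) ∂P) - ∫ x, u x * ρ s x) -
      ((∫ w, eulerPull (s - t) (V t) u (X t w) ∂P) -
        ∫ x, eulerPull (s - t) (V t) u x * ρ t x)| ≤
      (Z * (C * (1 + C) + C ^ 2) + M * R) * (s - t) ^ 2 := by
  have hVt : SmoothField (V t) := hVs.slice ht
  have hρt : Smooth (ρ t) := (hρ.2 t ht).1
  have hprob := isProbabilityMeasure_densityMeasure (hρ.2 t ht)
  have h1 := hR.abs_integral_sub_le hT hρ.1 hu.smooth hM hs ht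
  have h2 := hu.abs_expect_sub_le hZ hVs hV hX hdr hs ht
  have he := smooth_eulerPull hu.smooth hVt (s - t)
  have h3 := hu.abs_integral_sub_le hZ hVt (hV.norm_le t ht) (μ := densityMeasure (ρ t)) he
  rw [integral_densityMeasure_mul (hρ.2 t ht), integral_densityMeasure_mul (hρ.2 t ht),
    integral_densityMeasure_mul (hρ.2 t ht)] at h3
  -- The weak continuity equation: it cancels the first order terms of `h1` and `h3`.
  have h4 : ∫ x, u x * timeDeriv T ρ t x = ∫ x, dirDeriv u (V t) x * ρ t x := by
    rw [hVt.integral_dirDeriv hu.smooth hρt, ← integral_neg]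
    refine integral_congr_ae (Filter.Eventually.of_forall fun x => ?_)
    dsimp only
    rw [timeDeriv, (hc t ht x).derivWithin (uniqueDiffOn_Icc hT t ht), mul_neg]
  rw [h4] at h1
  rw [abs_le] at h1 h2 h3 ⊢
  constructor <;> linarith [h1.1, h1.2, h2.1, h2.2, h3.1, h3.2]

/-- One constant for both bounds makes the iteration geometric. With `y = hC`, the exponent `3`
comes from `(1 + y)² + y ≤ (1 + y)³`. -/
lemma TestBound.eulerPull_pow {u : Torus d → ℝ} {Z h t : ℝ} (hu : TestBound u Z Z) (hZ : 0 ≤ Z)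
    (hh : 0 ≤ h) (hVs : SmoothOnCylinder T V) (hV : CylinderBound T V C) (ht : t ∈ Icc 0 T) :
    TestBound (eulerPull h (V t) u) (Z * (1 + h * C) ^ 3)
      (Z * (1 + h * C) ^ 3) := by
  have hb := hu.testBound_eulerPull hZ hZ hh hV.nonneg (hVs.slice ht) (hV.fderiv_le t ht)
    (hV.fderiv_lipschitz t ht)
  have hy : 0 ≤ h * C := mul_nonneg hh hV.nonneg
  have hq : 1 + h * C ≤ (1 + h * C) ^ 3 := le_self_pow₀ (by linarith) (by norm_num)
  refine ⟨hb.smooth, fun v => (hb.fderiv_le v).trans (mul_le_mul_of_nonneg_left hq hZ),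
    fun v w => (hb.fderiv_lipschitz v w).trans
      (mul_le_mul_of_nonneg_right ?_ (norm_nonneg _))⟩
  rw [← mul_add]
  refine mul_le_mul_of_nonneg_left ?_ hZ
  nlinarith [pow_nonneg hy 2, pow_nonneg hy 3]

/-- Each step back in time replaces `u` by its Euler pullback, at the price of a quadratic error; at
time `0` the defect vanishes by the initial law. The induction must therefore range over all test
functions. -/
lemma abs_defect_le (hT : 0 < T) (hρ : IsDensityCurve T ρ)
    (hR : CylinderBound T ρ R) (hVs : SmoothOnCylinder T V) (hV : CylinderBound T V C)
    (hc : ContinuityEq T ρ V)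
    (hX : ∀ t ∈ Icc (0 : ℝ) T, AEMeasurable (X t) P) (hdr : IsDrivenBy P T V X)
    (h0 : ProbabilityTheory.HasLaw (X 0) (densityMeasure (ρ 0)) P)
    {h M : ℝ} (hh : 0 ≤ h) (k : ℕ) (hk : k * h ≤ T) {u : Torus d → ℝ} {Z : ℝ}
    (hZ : 0 ≤ Z) (hu : TestBound u Z Z) (hM : ∀ x, |u x| ≤ M) :
    |(∫ w, u (X (k * h) w) ∂P) - ∫ x, u x * ρ (k * h) x| ≤
      k * (Z * ((1 + h * C) ^ 3) ^ k * (C * (1 + C) + C ^ 2) + M * R) * h ^ 2 := by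
  induction k generalizing u Z with
  | zero =>
    simp only [Nat.cast_zero, zero_mul]
    rw [integral_comp_of_hasLaw hu.smooth (hρ.2 0 (left_mem_Icc.2 hT.le)) h0, sub_self, abs_zero]
  | succ k ih =>
    have hC := hV.nonneg
    have hk' : ((k : ℝ) + 1) * h ≤ T := by exact_mod_cast hk
    have hkh : (k : ℝ) * h ≤ T := by nlinarith
    have ht : (k : ℝ) * h ∈ Icc 0 T := ⟨by positivity, hkh⟩
    have hs : ((k + 1 : ℕ) : ℝ) * h ∈ Icc 0 T := ⟨by positivity, hk⟩
    have hst : ((k + 1 : ℕ) : ℝ) * h - k * h = h := by push_cast; ring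
    have h1 := hu.abs_defect_sub_le hT hρ hR hVs hV hc hX hdr hZ hM hs ht
    rw [hst] at h1
    have hq : 1 ≤ (1 + h * C) ^ 3 := one_le_pow₀ (by nlinarith [mul_nonneg hh hC])
    -- Composition does not increase the supremum, so `M` is unchanged; only `Z` grows.
    have h2 := ih hkh (u := eulerPull h (V (k * h)) u) (by positivity)
      (hu.eulerPull_pow hZ hh hVs hV ht) fun x => hM _
    have h3 := (abs_add_le _ _).trans (add_le_add h1 h2)
    rw [sub_add_cancel] at h3
    refine h3.trans ?_
    set Q := (1 + h * C) ^ 3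
    have h4 : Z * (C * (1 + C) + C ^ 2) ≤ Z * Q ^ (k + 1) * (C * (1 + C) + C ^ 2) := by
      have : Z * 1 ≤ Z * Q ^ (k + 1) := mul_le_mul_of_nonneg_left (one_le_pow₀ hq) hZ
      rw [mul_one] at this
      exact mul_le_mul_of_nonneg_right this (by positivity)
    calc _ ≤ (Z * Q ^ (k + 1) * (C * (1 + C) + C ^ 2) + M * R) * h ^ 2 +
          k * (Z * Q * Q ^ k * (C * (1 + C) + C ^ 2) + M * R) * h ^ 2 := by gcongr
      _ = _ := by push_cast; ring

/-- With `n + 1` steps of length `h = t / (n + 1)`, the growth factor stays below `exp (t C) ^ 3`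
and the total error is of order `(n + 1) h² = t² / (n + 1)`. -/
lemma expect_eq_of_continuityEq (hT : 0 < T) (hρ : IsDensityCurve T ρ)
    (hVs : SmoothOnCylinder T V) (hc : ContinuityEq T ρ V)
    (hX : ∀ t ∈ Icc (0 : ℝ) T, AEMeasurable (X t) P) (hdr : IsDrivenBy P T V X)
    (h0 : ProbabilityTheory.HasLaw (X 0) (densityMeasure (ρ 0)) P)
    {u : Torus d → ℝ} (hu : Smooth u) {t : ℝ} (ht : t ∈ Icc 0 T) :
    ∫ w, u (X t w) ∂P = ∫ x, u x * ρ t x := by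
  obtain ⟨R, hR⟩ := hρ.1.exists_cylinderBound hT
  obtain ⟨C, hV⟩ := hVs.exists_cylinderBound hT
  obtain ⟨A, B, hA, hB, hb⟩ := hu.exists_testBound
  obtain ⟨M, hM0, hM⟩ := hu.exists_bound
  have hC := hV.nonneg
  have hZ : TestBound u (A + B) (A + B) := ⟨hu, fun v => (hb.fderiv_le v).trans (by linarith),
    fun v w => (hb.fderiv_lipschitz v w).trans
      (mul_le_mul_of_nonneg_right (by linarith) (norm_nonneg _))⟩
  set G : ℝ := ((A + B) * Real.exp (t * C) ^ 3 * (C * (1 + C) + C ^ 2) + M * R) * t ^ 2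
  have key : ∀ n : ℕ, |(∫ w, u (X t w) ∂P) - ∫ x, u x * ρ t x| ≤ G * (1 / ((n : ℝ) + 1)) := by
    intro n
    have hn : (0 : ℝ) < (n : ℝ) + 1 := by positivity
    have hnt : ((n + 1 : ℕ) : ℝ) * (t / ((n : ℝ) + 1)) = t := by
      push_cast
      field_simp
    have hh : 0 ≤ t / ((n : ℝ) + 1) := div_nonneg ht.1 hn.le
    have h1 := abs_defect_le hT hρ hR hVs hV hc hX hdr h0 hh (n + 1) (by rw [hnt]; exact ht.2)
      (add_nonneg hA hB) hZ hM
    rw [hnt] at h1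
    refine h1.trans ?_
    have h2 : ((1 + t / ((n : ℝ) + 1) * C) ^ 3) ^ (n + 1) ≤ Real.exp (t * C) ^ 3 := by
      rw [← pow_mul, mul_comm 3, pow_mul]
      refine pow_le_pow_left₀ (by positivity) ?_ 3
      calc (1 + t / ((n : ℝ) + 1) * C) ^ (n + 1)
          ≤ Real.exp (t / ((n : ℝ) + 1) * C) ^ (n + 1) := by
            refine pow_le_pow_left₀ (by positivity) ?_ _
            linarith [Real.add_one_le_exp (t / ((n : ℝ) + 1) * C)]
        _ = Real.exp (t * C) := by
            rw [← Real.exp_nat_mul, ← mul_assoc, hnt]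
    calc _ ≤ ((n + 1 : ℕ) : ℝ) * ((A + B) * Real.exp (t * C) ^ 3 * (C * (1 + C) + C ^ 2) + M * R)
          * (t / ((n : ℝ) + 1)) ^ 2 := by gcongr
      _ = G * (1 / ((n : ℝ) + 1)) := by
          simp only [G]
          push_cast
          field_simp
  have hlim : Filter.Tendsto (fun n : ℕ => G * (1 / ((n : ℝ) + 1))) Filter.atTop (nhds 0) := by
    simpa using tendsto_one_div_add_atTop_nhds_zero_nat.const_mul G
  have := ge_of_tendsto' hlim key
  exact sub_eq_zero.1 (abs_nonpos_iff.1 this)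

end Particles

/-! ### Smooth functions determine measures -/

/-- Two finite measures on the torus with the same integrals of smooth functions agree. -/
lemma measure_ext_of_smooth {μ ν : Measure (Torus d)} [IsFiniteMeasure μ] [IsFiniteMeasure ν]
    (h : ∀ u : Torus d → ℝ, Smooth u → ∫ x, u x ∂μ = ∫ x, u x ∂ν) : μ = ν := by
  let A : StarSubalgebra ℝ (BoundedContinuousFunction (Torus d) ℝ) :=
    { carrier := {u | Smooth u}
      mul_mem' := fun ha hb => Smooth.mul ha hb
      add_mem' := fun ha hb => Smooth.add ha hb
      algebraMap_mem' := fun c => smooth_const c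
      star_mem' := fun ha => ha }
  refine ext_of_forall_mem_subalgebra_integral_eq_of_polish (A := A) ?_ fun g hg => h g hg
  intro x y hxy
  obtain ⟨i, hi⟩ := Function.ne_iff.1 hxy
  -- Points are separated by the real or the imaginary part of the character `exp (2π i x_i)` in a
  -- coordinate where they differ.
  have hsep : ∀ g : ℂ →L[ℝ] ℝ, g (fourier 1 (x i)) ≠ g (fourier 1 (y i)) →
      ∃ f ∈ (fun f : C(Torus d, ℝ) => (f : Torus d → ℝ)) ''
        (A.map (BoundedContinuousFunction.toContinuousMapStarₐ ℝ) : Set C(Torus d, ℝ)),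
        f x ≠ f y := by
    intro g hg
    have hs : Smooth fun z : Torus d => g (fourier 1 (z i)) := by
      unfold Smooth proj
      simp only [fourier_coe_apply]
      refine g.contDiff.comp (Complex.contDiff_exp.comp ?_)
      have : ContDiff ℝ ∞ fun v : Vec d => ((v i : ℝ) : ℂ) :=
        Complex.ofRealCLM.contDiff.comp (EuclideanSpace.proj i : Vec d →L[ℝ] ℝ).contDiff
      fun_prop
    refine ⟨_, ⟨⟨_, hs.continuous⟩, ⟨BoundedContinuousFunction.mkOfCompact ⟨_, hs.continuous⟩,
      hs, rfl⟩, rfl⟩, hg⟩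
  have hne : fourier 1 (x i) ≠ fourier 1 (y i) := by
    simp only [fourier_one]
    intro hcon
    exact hi (AddCircle.injective_toCircle one_ne_zero (Subtype.ext hcon))
  by_cases hre : (fourier 1 (x i)).re = (fourier 1 (y i)).re
  · exact hsep Complex.imCLM fun him => hne (Complex.ext hre him)
  · exact hsep Complex.reCLM hre

/-! ### Laws of the particles. -/

section Particles

variable {Ω : Type*} [MeasurableSpace Ω] {P : Measure Ω} [IsProbabilityMeasure P]
  {X : ℝ → Ω → Torus d}

/-- Measurability of `X t` is not assumed for `t > 0`: by uniqueness `X t` is almost surely the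
measurable flow map applied to `X 0`. Its law is then determined by smooth test functions. -/
lemma hasDensity_of_continuityEq (hT : 0 < T) (hρ : IsDensityCurve T ρ)
    (hVs : SmoothOnCylinder T V) (hc : ContinuityEq T ρ V)
    (h0 : ProbabilityTheory.HasLaw (X 0) (densityMeasure (ρ 0)) P) (hdr : IsDrivenBy P T V X) :
    HasDensity P T ρ X := by
  obtain ⟨C, hV⟩ := hVs.exists_cylinderBound hT
  obtain ⟨Fl, -, hFm, -, hFu⟩ := hV.exists_flow hT
  have hX : ∀ t ∈ Icc (0 : ℝ) T, AEMeasurable (X t) P := fun t ht =>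
    ((hFm t ht).comp_aemeasurable h0.aemeasurable).congr
      (hdr.mono fun w hw => (hFu _ hw t ht).symm)
  intro t ht
  refine ⟨hX t ht, ?_⟩
  have h1 := isProbabilityMeasure_densityMeasure (hρ.2 t ht)
  have h2 := Measure.isProbabilityMeasure_map (hX t ht)
  refine measure_ext_of_smooth fun u hu => ?_
  rw [integral_map (hX t ht) hu.continuous.aestronglyMeasurable,
    integral_densityMeasure_mul (hρ.2 t ht)]
  exact expect_eq_of_continuityEq hT hρ hVs hc hX hdr h0 hu ht

lemma exists_process_of_continuityEq (hT : 0 < T) (hρ : IsDensityCurve T ρ)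
    (hVs : SmoothOnCylinder T V) (hc : ContinuityEq T ρ V) {X₀ : Ω → Torus d}
    (h0 : ProbabilityTheory.HasLaw X₀ (densityMeasure (ρ 0)) P) :
    ∃ X : ℝ → Ω → Torus d, X 0 = X₀ ∧ HasDensity P T ρ X ∧ IsDrivenBy P T V X := by
  obtain ⟨C, hV⟩ := hVs.exists_cylinderBound hT
  obtain ⟨Fl, hF0, -, hFs, -⟩ := hV.exists_flow hT
  have hX0 : (fun w => Fl 0 (X₀ w)) = X₀ := funext fun w => hF0 _
  have hdr : IsDrivenBy P T V fun t w => Fl t (X₀ w) :=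
    Filter.Eventually.of_forall fun w => hFs (X₀ w)
  refine ⟨fun t w => Fl t (X₀ w), hX0, ?_, hdr⟩
  exact hasDensity_of_continuityEq hT hρ hVs hc (by rw [hX0]; exact h0) hdr

/-- The particle formulation of the transport Newton flow. -/
theorem newtonFlow_particles (hT : 0 < T) (hρ : IsDensityCurve T ρ) {X₀ : Ω → Torus d}
    (h0 : ProbabilityTheory.HasLaw X₀ (densityMeasure (ρ 0)) P)
    {E : (Torus d → ℝ) → ℝ} {K : (Torus d → ℝ) → Torus d → Torus d → ℝ}
    {N : (Torus d → ℝ) → Torus d → Torus d → Matrix (Fin d) (Fin d) ℝ}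
    (hh : ∀ t ∈ Icc (0 : ℝ) T, Smooth (firstVariation E (ρ t)))
    (hN : ∀ t ∈ Icc (0 : ℝ) T, IsGradGrad (K (ρ t)) (N (ρ t)))
    (hK : ∀ t ∈ Icc (0 : ℝ) T, IsInverseKernel E (ρ t) (K (ρ t)))
    (hV : ∀ t ∈ Icc (0 : ℝ) T, ∀ x, newtonDrift E N (ρ t) x = V t x) :
    (IsNewtonFlow E T ρ ↔ SmoothOnCylinder T V ∧ ∃ X : ℝ → Ω → Torus d,
      X 0 = X₀ ∧ HasDensity P T ρ X ∧ IsDrivenBy P T V X) ∧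
    (IsNewtonFlow E T ρ → ∀ X : ℝ → Ω → Torus d,
      ProbabilityTheory.HasLaw (X 0) (densityMeasure (ρ 0)) P → IsDrivenBy P T V X →
      HasDensity P T ρ X) := by
  -- `V` need only agree with the drift on `[0,T]`, so both `newtonDrift` and `klDrift` are covered.
  have key : IsNewtonFlow E T ρ ↔ SmoothOnCylinder T V ∧ ContinuityEq T ρ V := by
    rw [isNewtonFlow_iff hρ hh hN hK]
    refine and_congr (contDiffOn_congr fun p hp => hV p.1 hp.1 _) ?_
    refine forall₃_congr fun t ht x => ?_
    simp only [hV t ht]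
  refine ⟨?_, fun H X hX0 hdr => ?_⟩
  · rw [key]
    refine and_congr_right fun hVs => ⟨fun hc => ?_, ?_⟩
    · exact exists_process_of_continuityEq hT hρ hVs hc h0
    · rintro ⟨X, -, hX, hdr⟩
      exact continuityEq_of_isDrivenBy hT hρ hVs hX hdr
  · obtain ⟨hVs, hc⟩ := key.1 H
    exact hasDensity_of_continuityEq hT hρ hVs hc hX0 hdr

end Particles

end TransportNewton
theorem mainTheorem10 {d : ℕ} {Ω : Type*} [MeasurableSpace Ω] (P : MeasureTheory.Measure Ω)
    [MeasureTheory.IsProbabilityMeasure P] (T : ℝ) (hT : 0 < T)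
    (ρ : ℝ → TransportNewton.Torus d → ℝ) (hρ : TransportNewton.IsDensityCurve T ρ)
    (X₀ : Ω → TransportNewton.Torus d)
    (hX₀ : ProbabilityTheory.HasLaw X₀ (TransportNewton.densityMeasure (ρ 0)) P)
    (K : (TransportNewton.Torus d → ℝ) →
      TransportNewton.Torus d → TransportNewton.Torus d → ℝ)
    (N : (TransportNewton.Torus d → ℝ) →
      TransportNewton.Torus d → TransportNewton.Torus d → Matrix (Fin d) (Fin d) ℝ)
    (hN : ∀ t ∈ Set.Icc (0 : ℝ) T, TransportNewton.IsGradGrad (K (ρ t)) (N (ρ t))) :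
    -- general energies
    (∀ E : (TransportNewton.Torus d → ℝ) → ℝ, TransportNewton.IsSmoothFunctional E →
      (∀ t ∈ Set.Icc (0 : ℝ) T, TransportNewton.IsInverseKernel E (ρ t) (K (ρ t))) →
      (TransportNewton.IsNewtonFlow E T ρ ↔
        TransportNewton.SmoothOnCylinder T
          (fun t => TransportNewton.newtonDrift E N (ρ t)) ∧
        ∃ X : ℝ → Ω → TransportNewton.Torus d, X 0 = X₀ ∧
          TransportNewton.HasDensity P T ρ X ∧
          TransportNewton.IsDrivenBy P T
            (fun t => TransportNewton.newtonDrift E N (ρ t)) X) ∧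
      (TransportNewton.IsNewtonFlow E T ρ →
        ∀ X : ℝ → Ω → TransportNewton.Torus d,
          ProbabilityTheory.HasLaw (X 0) (TransportNewton.densityMeasure (ρ 0)) P →
          TransportNewton.IsDrivenBy P T
            (fun t => TransportNewton.newtonDrift E N (ρ t)) X →
          TransportNewton.HasDensity P T ρ X)) ∧
    -- the KL divergence
    (∀ f : TransportNewton.Torus d → ℝ, TransportNewton.Smooth f →
      (∀ t ∈ Set.Icc (0 : ℝ) T,
        TransportNewton.IsInverseKernel (TransportNewton.klEnergy f) (ρ t) (K (ρ t))) →
      ∀ L : (TransportNewton.Torus d → ℝ) →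
        TransportNewton.Torus d → TransportNewton.Torus d → TransportNewton.Vec d,
      (∀ t ∈ Set.Icc (0 : ℝ) T, TransportNewton.IsGradLaplacian (K (ρ t)) (L (ρ t))) →
      (∀ t ∈ Set.Icc (0 : ℝ) T, ∀ x,
        TransportNewton.newtonDrift (TransportNewton.klEnergy f) N (ρ t) x =
          TransportNewton.klDrift f N L (ρ t) x) ∧
      (TransportNewton.IsNewtonFlow (TransportNewton.klEnergy f) T ρ ↔
        TransportNewton.SmoothOnCylinder T
          (fun t => TransportNewton.klDrift f N L (ρ t)) ∧
        ∃ X : ℝ → Ω → TransportNewton.Torus d, X 0 = X₀ ∧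
          TransportNewton.HasDensity P T ρ X ∧
          TransportNewton.IsDrivenBy P T
            (fun t => TransportNewton.klDrift f N L (ρ t)) X) ∧
      (TransportNewton.IsNewtonFlow (TransportNewton.klEnergy f) T ρ →
        ∀ X : ℝ → Ω → TransportNewton.Torus d,
          ProbabilityTheory.HasLaw (X 0) (TransportNewton.densityMeasure (ρ 0)) P →
          TransportNewton.IsDrivenBy P T
            (fun t => TransportNewton.klDrift f N L (ρ t)) X →
          TransportNewton.HasDensity P T ρ X)) := by
  refine ⟨fun E hE hK => ?_, fun f hf hK L hL => ?_⟩
  · exact TransportNewton.newtonFlow_particles hT hρ hX₀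
      (fun t ht => (TransportNewton.IsFirstVariation.firstVariation
        (hE.first _ (hρ.2 t ht))).1) hN hK fun _ _ _ => rfl
  · have hV : ∀ t ∈ Set.Icc (0 : ℝ) T, ∀ x,
        TransportNewton.newtonDrift (TransportNewton.klEnergy f) N (ρ t) x =
          TransportNewton.klDrift f N L (ρ t) x := fun t ht =>
      TransportNewton.newtonDrift_klEnergy hf (hρ.2 t ht) (hK t ht).integrable (hN t ht) (hL t ht)
    exact ⟨hV, TransportNewton.newtonFlow_particles hT hρ hX₀
      (fun t ht => (TransportNewton.IsFirstVariation.firstVariation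
        ⟨_, TransportNewton.isFirstVariation_klEnergy hf (hρ.2 t ht)⟩).1) hN hK hV⟩
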